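/- **Setup.** A probability measure $D$ on $\mathbb R^d$ is *1-Poincaré* if $\operatorname{Var}_{D}[f]\le \mathbb E_{D}\|\nabla f\|^2$ for all differentiable $f:\mathbb R^d\to\mathbb R$; $D(\mu)$ is $D$ shifted by $\mu$, and $\|\cdot\|$ is the $\ell_2$ norm. Let $M=w_1D(\mu_1)+\dots+w_kD(\mu_k)$ with $w_i\ge 0$, $\sum_i w_i=1$, $\mu_i\in\mathbb R^d$, and $\mu_{\max}=\max(1,\|\mu_1\|,\dots,\|\mu_k\|)$. *Estimator.* For a tensor $T$ of order $|S|$, $T^{(S)}$ denotes $T$ placed in the dimensions $S\subseteq[t]$. Put $D_a=\mathbb E_{z\sim D}[z^{\otimes a}]$, $P_0(x)=1$, and $$P_t(x)=x^{\otimes t}-\sum_{\emptyset\ne S\subseteq[t]}D_{|S|}^{(S)}\otimes P_{t-|S|}(x)^{([t]\setminus S)},$$ $$Q_t(x_1,\dots,x_t)=\sum_{S_1\sqcup\dots\sqcup S_t=[t]}\frac{(-1)^{c}}{\binom{t-1}{c-1}}\,P_{|S_1|}(x_1)^{(S_1)}\otimes\dots\otimes P_{|S_t|}(x_t)^{(S_t)},$$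 where the sum is over ordered partitions into possibly empty parts and $c$ is the number of nonempty parts, and $$R_t(x_1,\dots,x_{2t})=-Q_t(x_1,\dots,x_t)+Q_t(x_{t+1},\dots,x_{2t}).$$ *Nested projections.* Let $c_0=1$, $c_1=d$ and $c_s=\min(k,d\,c_{s-1})$ for $s\ge2$ (so $c_s=k$ for all $s\ge1$ if $k=d$). For $\Pi_s\in\mathbb R^{c_s\times dc_{s-1}}$ define the $c_s\times d^s$ matrices $\Gamma_0=1$, $\Gamma_s=\Gamma_{\Pi_s,\dots,\Pi_1}=\Pi_s(I_d\otimes_{\rm kr}\Gamma_{s-1})$. *Iterative projection algorithm.* Input: an integer $t>0$ and $n$ independent samples from $M$, split into $t$ sets $S_1,\dots,S_t$ of size $\lfloor n/t\rfloor$ (leftover samples are discarded). Set $\Pi_1=I_d$. For $s=2,\dots,t$: for each $z\in S_s$ draw fresh independent samples $x_1,\dots,x_{4s-1}\sim D$, form the vector $$\bigl((I_d\otimes_{\rm kr}\Gamma_{s-1})\otimes_{\rm kr}(I_d\otimes_{\rm kr}\Gamma_{s-1})\bigr)\operatorname{flat}\bigl(R_{2s}(z,x_1,\dots,x_{4s-1})\bigr)$$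 and rearrange it into a $dc_{s-1}\times dc_{s-1}$ matrix; let $\widetilde A_{2s}$ be the average of these matrices over $z\in S_s$; let the rows of $\Pi_s\in\mathbb R^{c_s\times dc_{s-1}}$ be an orthonormal basis of a top-$c_s$ singular subspace of $\widetilde A_{2s}$, computed from $\widetilde A_{2s}$ by an arbitrary fixed Borel measurable rule (which breaks ties and chooses the basis). Output $(\Pi_t,\dots,\Pi_1)$. **Lemma 6.2.** There is a universal constant $C$ such that the following holds for all $d$, $k$, $n$, all $t\ge1$, every 1-Poincaré probability measure $D$ on $\mathbb R^d$, every mixture $M=w_1D(\mu_1)+\dots+w_kD(\mu_k)$, all $w^*,\varepsilon>0$, and every such rule. If $$n\ \ge\ \left(\frac{t^t\,\mu_{\max}^t\,k\,d}{w^*\varepsilon}\right)^{C},$$ then with probability at least $1-n^{-0.2}$ over the samples from $M$ and $D$, the output of the algorithm satisfies: for every $i\in[k]$ with $\|\mu_i\|\ge1$ and $w_i\ge w^*$, $$\bigl\|\Gamma_{\Pi_s,\dots,\Pi_1}\operatorname{flat}(\mu_i^{\otimes s})\bigr\|\ \ge\ (1-s\varepsilon)\,\|\mu_i\|^s\qquad\text{for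 all } s=1,2,\dots,t.$$ -/

import Mathlib

open MeasureTheory ProbabilityTheory
open scoped ENNReal Kronecker Gradient

noncomputable section

namespace ImplicitMoments

/-- `ℝ^d` with the `ℓ₂` norm. -/
abbrev Vec (d : ℕ) : Type := EuclideanSpace ℝ (Fin d)

/-! ### Distributions -/

/-- `D` is `σ`-Poincaré: `Var_D[f] ≤ σ² E_D[‖∇f‖²]` for every differentiable `f : ℝ^d → ℝ`.
Both sides are taken in `[0, ∞]`, so no junk value occurs when `f` is not square integrable
(`evariance` is then `∞`). -/
def IsPoincare {d : ℕ} (σ : ℝ) (D : Measure (Vec d)) : Prop :=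
  ∀ f : Vec d → ℝ, Differentiable ℝ f →
    evariance f D ≤ ENNReal.ofReal (σ ^ 2) * ∫⁻ z, ‖∇ f z‖ₑ ^ 2 ∂D

/-- `D(μ)`: the distribution `D` shifted by the vector `μ`. -/
def shift {d : ℕ} (D : Measure (Vec d)) (μ : Vec d) : Measure (Vec d) :=
  D.map (fun z => z + μ)

/-- The mixture `w_1 D(μ_1) + ⋯ + w_k D(μ_k)`. -/
def mixture {d k : ℕ} (D : Measure (Vec d)) (w : Fin k → ℝ) (μ : Fin k → Vec d) :
    Measure (Vec d) :=
  ∑ i, ENNReal.ofReal (w i) • shift D (μ i)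

/-- `μ_max = max(1, ‖μ_1‖, …, ‖μ_k‖)`. -/
def muMax {d k : ℕ} (μ : Fin k → Vec d) : ℝ := max 1 (⨆ i, ‖μ i‖)

/-! ### Tensors and the adjusted polynomials -/

/-- Order-`t` tensors with all dimensions equal to `d`. Its multi-indices `Fin t → Fin d` also serve
as the indices of the flattening, a vector of length `d ^ t`. -/
abbrev Tensor (d t : ℕ) : Type := (Fin t → Fin d) → ℝ

/-- The tensor power `x^{⊗ t}`. -/
def tensorPow {d : ℕ} (x : Vec d) (t : ℕ) : Tensor d t := fun η => ∏ j, x (η j)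

/-- `D_t = E_{z ∼ D}[z^{⊗ t}]`. -/
def momentTensor {d : ℕ} (D : Measure (Vec d)) (t : ℕ) : Tensor d t :=
  fun η => ∫ z, tensorPow z t η ∂D

/-- The factor `T^{(S)}` of a tensor product of order `t`: the tensor `T` of order `|S|` put in the
dimensions indexed by `S ⊆ [t]`, as a function of the full multi-index `η`. A tensor product
`T₁^{(S₁)} ⊗ ⋯ ⊗ T_a^{(S_a)}` over a partition of `[t]` has the entries `∏ i, place Tᵢ Sᵢ η`. -/
def place {d t : ℕ} (S : Finset (Fin t)) (T : Tensor d S.card) (η : Fin t → Fin d) : ℝ :=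
  T (fun i => η (S.orderEmbOfFin rfl i))

/-- The `D`-adjusted polynomials: `P_0(x) = 1` and
`P_t(x) = x^{⊗ t} - ∑_sym D_1 ⊗ P_{t-1}(x) - ∑_sym D_2 ⊗ P_{t-2}(x) - ⋯ - D_t`.
The symmetrized sums for `a = 1, …, t` are written as one sum over the nonempty sets `S ⊆ [t]` of
dimensions that the factor `D_a`, `a = |S|`, occupies. -/
def adjPoly {d : ℕ} (D : Measure (Vec d)) (x : Vec d) : (t : ℕ) → Tensor d t
  | t => fun η => tensorPow x t η -
      ∑ S : {S : Finset (Fin t) // S.Nonempty},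
        place S.1 (momentTensor D S.1.card) η * place S.1ᶜ (adjPoly D x S.1ᶜ.card) η
  termination_by t => t
  decreasing_by
    have h := S.2.card_pos
    have h' := Finset.card_add_card_compl S.1
    rw [Fintype.card_fin] at h'
    omega

/-- An ordered partition `S_1 ∪ ⋯ ∪ S_t = [t]` into possibly empty disjoint parts is given by the
map `p : [t] → [t]` that sends an element to the number of its part; this is the part `S_i`. -/
def part {t : ℕ} (p : Fin t → Fin t) (i : Fin t) : Finset (Fin t) :=
  Finset.univ.filter (fun j => p j = i)

/-- `𝒞{S_1, …, S_t}`: the number of nonempty parts. -/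
def numParts {t : ℕ} (p : Fin t → Fin t) : ℕ :=
  (Finset.univ.filter (fun i => (part p i).Nonempty)).card

/-- `Q_t(x_1, …, x_t) = ∑_{S_1 ∪ ⋯ ∪ S_t = [t]} (-1)^𝒞 / binom(t-1, 𝒞-1)
P_{|S_1|}(x_1)^{(S_1)} ⊗ ⋯ ⊗ P_{|S_t|}(x_t)^{(S_t)}`. -/
def polyQ {d : ℕ} (D : Measure (Vec d)) (t : ℕ) (x : Fin t → Vec d) : Tensor d t :=
  fun η => ∑ p : Fin t → Fin t,
    ((-1 : ℝ) ^ numParts p / ((t - 1).choose (numParts p - 1) : ℝ)) *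
      ∏ i, place (part p i) (adjPoly D (x i) (part p i).card) η

/-- `R_t(x_1, …, x_{2t}) = -Q_t(x_1, …, x_t) + Q_t(x_{t+1}, …, x_{2t})`. -/
def polyR {d : ℕ} (D : Measure (Vec d)) (t : ℕ) (x : Fin (2 * t) → Vec d) : Tensor d t :=
  fun η => - polyQ D t (fun i => x ⟨i, by omega⟩) η + polyQ D t (fun i => x ⟨t + i, by omega⟩) η

/-! ### Nested projections -/

/-- `Π (I_d ⊗_kr Γ)`, where the columns of `Γ` are indexed by the entries of tensors of order `s` and
those of the result by the entries of tensors of order `s + 1`. -/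
def nestStep {d s c c' : ℕ} (P : Matrix (Fin c') (Fin d × Fin c) ℝ)
    (Γ : Matrix (Fin c) (Fin s → Fin d) ℝ) : Matrix (Fin c') (Fin (s + 1) → Fin d) ℝ :=
  (P * ((1 : Matrix (Fin d) (Fin d) ℝ) ⊗ₖ Γ)).submatrix id (fun η => (η 0, Fin.tail η))

/-- The nested projection `Γ_{Π_s, …, Π_1} = Π_s (I_d ⊗ Π_{s-1} (I_d ⊗ ⋯))`, a `c_s × d^s` matrix.
Here `P r` is the matrix `Π_{r+1} ∈ ℝ^{c_{r+1} × d c_r}`, and `c_0 = 1`, so that the matrix for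
`s = 0` is the `1 × 1` identity. -/
def nestedProj {d : ℕ} (c : ℕ → ℕ) (P : ∀ r, Matrix (Fin (c (r + 1))) (Fin d × Fin (c r)) ℝ) :
    (s : ℕ) → Matrix (Fin (c s)) (Fin s → Fin d) ℝ
  | 0 => Matrix.of fun _ _ => 1
  | s + 1 => nestStep (P s) (nestedProj c P s)

/-! ### The algorithms -/

/-- The matrix `K_i` of the estimator for step `s = r + 1`, built from one sample `z` of the mixture
and `4s - 1` samples `x` of `D`: the vector
`X = ((I_d ⊗_kr Γ) ⊗_kr (I_d ⊗_kr Γ)) flat(R_{2s}(z, x_1, …, x_{4s-1}))`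
rearranged into a square matrix. A multi-index of order `2s` is split into its first and its last `s`
entries, and each half into its first entry and the `r = s - 1` others. -/
def sampleMatrix {d c r : ℕ} (D : Measure (Vec d)) (Γ : Matrix (Fin c) (Fin r → Fin d) ℝ)
    (z : Vec d) (x : Fin (4 * (r + 1) - 1) → Vec d) :
    Matrix (Fin d × Fin c) (Fin d × Fin c) ℝ :=
  let W : Matrix (Fin d × Fin c) (Fin d × (Fin r → Fin d)) ℝ :=
    (1 : Matrix (Fin d) (Fin d) ℝ) ⊗ₖ Γ
  let args : Fin (2 * (2 * (r + 1))) → Vec d := fun j =>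
    (Fin.cons z x : Fin (4 * (r + 1) - 1 + 1) → Vec d) (Fin.cast (by omega) j)
  let R : (Fin d × (Fin r → Fin d)) × (Fin d × (Fin r → Fin d)) → ℝ := fun q =>
    polyR D (2 * (r + 1)) args (fun j =>
      Fin.append (Fin.cons q.1.1 q.1.2 : Fin (r + 1) → Fin d) (Fin.cons q.2.1 q.2.2)
        (Fin.cast (by omega) j))
  Matrix.of fun a b => ((W ⊗ₖ W).mulVec R) (a, b)

/-- Estimate Moment Tensor, for step `s = r + 1` and `Γ = Γ_{Π_{s-1}, …, Π_1}`: the average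
`(K_1 + ⋯ + K_m) / m` over the `m` given samples. -/
def estimateMoment {d c r m : ℕ} (D : Measure (Vec d)) (Γ : Matrix (Fin c) (Fin r → Fin d) ℝ)
    (z : Fin m → Vec d) (x : Fin m → Fin (4 * (r + 1) - 1) → Vec d) :
    Matrix (Fin d × Fin c) (Fin d × Fin c) ℝ :=
  (m : ℝ)⁻¹ • ∑ i, sampleMatrix D Γ (z i) (x i)

/-- The rows of `P` form an orthonormal basis of a top-`r` singular subspace of the square matrix
`A`, that is, of the span of the (right) singular vectors for the `r` largest singular values:
`v` is an orthonormal basis of singular vectors and `σ` lists the singular values in decreasing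
order. (The matrices in the algorithm are symmetric, so left and right do not differ.) -/
def IsTopSingularBasis {ι : Type} [Fintype ι] [DecidableEq ι] {r : ℕ}
    (A : Matrix ι ι ℝ) (P : Matrix (Fin r) ι ℝ) : Prop :=
  P * P.transpose = 1 ∧
    ∃ (v : OrthonormalBasis (Fin (Fintype.card ι)) ℝ (EuclideanSpace ℝ ι))
      (σ : Fin (Fintype.card ι) → ℝ),
      Antitone σ ∧ (∀ j, 0 ≤ σ j) ∧
      (∀ j, (A.transpose * A).mulVec (v j).ofLp = σ j ^ 2 • (v j).ofLp) ∧
      Submodule.span ℝ (Set.range fun a => (WithLp.toLp 2 (P.row a) : EuclideanSpace ℝ ι)) =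
        Submodule.span ℝ (v '' {j | (j : ℕ) < r})

/-- The numbers of rows `c_0 = 1`, `c_1 = d` and `c_s = min(k, d c_{s-1})` of `Π_s` for `s ≥ 2`.
For `k = d` they are `c_s = k` for all `s ≥ 1`. -/
def rows (k d : ℕ) : ℕ → ℕ
  | 0 => 1
  | 1 => d
  | s + 2 => min k (d * rows k d (s + 1))

theorem rows_eq_of_eq (k s : ℕ) : rows k k (s + 1) = k := by
  induction s with
  | zero => rfl
  | succ s ih =>
    simp only [rows, ih]
    exact min_eq_left (Nat.le_mul_self k)

/-- A routine that computes, in step `r + 1` of the algorithm, the matrix `Π_{r+1}` from the estimated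
matrix. -/
abbrev Routine (k d : ℕ) : Type :=
  ∀ r, Matrix (Fin d × Fin (rows k d r)) (Fin d × Fin (rows k d r)) ℝ →
    Matrix (Fin (rows k d (r + 1))) (Fin d × Fin (rows k d r)) ℝ

/-- The routine always returns an orthonormal basis of a top singular subspace of its input, and its
output is a Borel function of its input. Nothing is said about which basis, or which subspace in case
of ties, is returned. -/
def IsSingularRoutine {k d : ℕ} (svd : Routine k d) : Prop :=
  ∀ r, (∀ A, IsTopSingularBasis A (svd r A)) ∧
    ∀ a b, Measurable fun A : Fin d × Fin (rows k d r) → Fin d × Fin (rows k d r) → ℝ =>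
      svd r (Matrix.of A) a b

/-- The samples that the algorithm uses: `n` samples from the mixture, and for each step
`s = 1, …, t` and each of the `⌊n/t⌋` mixture samples of that step, `4s - 1` samples from `D`. -/
abbrev Samples (d n t : ℕ) : Type :=
  (Fin n → Vec d) × ((r : Fin t) → Fin (n / t) → Fin (4 * ((r : ℕ) + 1) - 1) → Vec d)

/-- All samples are independent. -/
def sampleLaw {d k : ℕ} (D : Measure (Vec d)) (w : Fin k → ℝ) (μ : Fin k → Vec d) (n t : ℕ) :
    Measure (Samples d n t) :=
  (Measure.pi fun _ : Fin n => mixture D w μ).prod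
    (Measure.pi fun _ => Measure.pi fun _ => Measure.pi fun _ => D)

/-- The set `S_{r+1}` of mixture samples when the `n` samples are split, in order, into `t` sets of
equal size `⌊n/t⌋` (a remainder of fewer than `t` samples is not used). -/
def batch {d n t : ℕ} (z : Fin n → Vec d) (r : Fin t) (i : Fin (n / t)) : Vec d :=
  z (Fin.castLE (Nat.mul_div_le n t) (finProdFinEquiv (r, i)))

/-- Step `r + 1` of the algorithm, given `Γ = Γ_{Π_r, …, Π_1}`: the first matrix is `Π_1 = I_d`, and
`Π_{r+1}` for `1 ≤ r < t` has as rows an orthonormal basis of the top singular subspace of the estimated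
matrix. (Only the steps with `r < t` are ever used.) -/
def stepMatrix {d k n t : ℕ} (D : Measure (Vec d)) (svd : Routine k d) (ω : Samples d n t) :
    (r : ℕ) → Matrix (Fin (rows k d r)) (Fin r → Fin d) ℝ →
      Matrix (Fin (rows k d (r + 1))) (Fin d × Fin (rows k d r)) ℝ
  | 0, _ => Matrix.of fun (a : Fin d) b => if a = b.1 then 1 else 0
  | r + 1, Γ =>
    if h : r + 1 < t then
      svd (r + 1) (estimateMoment D Γ (batch ω.1 ⟨r + 1, h⟩) (ω.2 ⟨r + 1, h⟩))
    else 0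

/-- The matrices `Γ_{Π_s, …, Π_1}` as they arise while the algorithm runs. -/
def runProj {d k n t : ℕ} (D : Measure (Vec d)) (svd : Routine k d) (ω : Samples d n t) :
    (s : ℕ) → Matrix (Fin (rows k d s)) (Fin s → Fin d) ℝ
  | 0 => Matrix.of fun _ _ => 1
  | s + 1 => nestStep (stepMatrix D svd ω s (runProj D svd ω s)) (runProj D svd ω s)

/-- The output `(Π_t, …, Π_1)` of the iterative projection algorithm: `iterProj D svd ω r` is
`Π_{r+1}`, for `r < t`. -/
def iterProj {d k n t : ℕ} (D : Measure (Vec d)) (svd : Routine k d) (ω : Samples d n t) (r : ℕ) :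
    Matrix (Fin (rows k d (r + 1))) (Fin d × Fin (rows k d r)) ℝ :=
  stepMatrix D svd ω r (runProj D svd ω r)

/-- In each step the algorithm indeed works with the nested projection of the matrices that it has
computed so far. -/
theorem nestedProj_iterProj {d k n t : ℕ} (D : Measure (Vec d)) (svd : Routine k d)
    (ω : Samples d n t) (s : ℕ) :
    nestedProj (rows k d) (iterProj D svd ω) s = runProj D svd ω s := by
  induction s with
  | zero => rfl
  | succ s ih => simp only [nestedProj, runProj, ih, iterProj]

end ImplicitMoments

end

/-! Replace the moment recursion for `adjPoly` by its closed form: the moments of `D`, as a function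
of sets of positions, have a convolution inverse `posCoeff`, and the adjusted polynomial is the
convolution of that inverse with monomials. This makes it an Appell family: its mean vanishes on
nonempty position sets, a shift expands binomially (`posPoly_add`), and a derivative deletes one
position (`hasFDerivAt_posPoly`).

Mean of the estimator: for a sample from `D(μ)`, the shift formula expands `Q` into products of
independent factors. Only the term with every position filled by `μ` has nonzero mean, so `-Q` has
mean `μ^{⊗ t}`; the second copy in `R` does not contain the mixture sample and has mean zero
(`integral_polyR`).

Variance of the estimator: a linear form in such products is mean zero in each sample that occurs,
so the Poincaré inequality in that sample trades it for forms with one position fewer. Iterating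
gives a second moment of at most `(n!)² K^n ‖v‖²`, independent of `d`
(`lintegral_sum_blockPoly_sq_le`). The rows of `(I ⊗ Γ) ⊗ (I ⊗ Γ)` are unit vectors, so every entry
of a sample matrix has bounded second moment and averaging controls the Frobenius error. Each step
uses a fresh batch, hence `Γ` is independent of it (`lintegral_runError_le`); Markov's inequality
and a union bound finish the probabilistic part.

Linear algebra: the mean matrix is `∑ w_i u_i u_iᵀ`, where `u_i` is the lift of `μ_i`. If the
estimate is within `δ` of it in Frobenius norm, the part `x` of `u_i` missed by the top singular
subspace satisfies `w_i ‖x‖⁴ ≤ 2 δ ‖x‖²` (`le_mulVec_dotProduct`). So each step loses at most `2 δ /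
w_i ≤ ε` from the squared norm, which is a relative loss of at most `ε` because `‖μ_i‖ ≥ 1`. -/

noncomputable section

namespace ImplicitMoments

/-! ### Adjusted polynomials indexed by finite sets of positions -/

section Adjusted

variable {ι : Type*} {d : ℕ}

/-- The mixed moment `E_{z ∼ D} ∏_{j ∈ T} z_{η j}`. -/
def posMoment (D : Measure (Vec d)) (η : ι → Fin d) (T : Finset ι) : ℝ :=
  ∫ z, ∏ j ∈ T, z (η j) ∂D

theorem posMoment_empty (D : Measure (Vec d)) (η : ι → Fin d)
    [IsProbabilityMeasure D] : posMoment D η ∅ = 1 := by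
  simp [posMoment]

variable [DecidableEq ι]

theorem sum_powerset_sdiff_comm (S : Finset ι) (g : Finset ι → Finset ι → ℝ) :
    ∑ T ∈ S.powerset, ∑ U ∈ (S \ T).powerset, g T U =
      ∑ U ∈ S.powerset, ∑ T ∈ (S \ U).powerset, g T U := by
  apply Finset.sum_comm'
  intro T U
  simp only [Finset.mem_powerset, Finset.subset_sdiff]
  constructor
  · rintro ⟨h1, h2, h3⟩; exact ⟨⟨h1, h3.symm⟩, h2⟩
  · rintro ⟨⟨h1, h3⟩, h2⟩; exact ⟨h1, h2, h3.symm⟩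

theorem sum_powerset_powerset (S : Finset ι) (g : Finset ι → Finset ι → ℝ) :
    ∑ T ∈ S.powerset, ∑ U ∈ T.powerset, g T U =
      ∑ U ∈ S.powerset, ∑ T ∈ (S \ U).powerset, g (T ∪ U) U := by
  rw [Finset.sum_comm' (t' := S.powerset) (s' := fun U => S.powerset.filter (U ⊆ ·))]
  · refine Finset.sum_congr rfl fun U hU => ?_
    rw [Finset.mem_powerset] at hU
    refine Finset.sum_bij' (fun T _ => T \ U) (fun T _ => T ∪ U) ?_ ?_ ?_ ?_ ?_
    · intro T hT
      simp only [Finset.mem_filter, Finset.mem_powerset] at hT ⊢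
      exact Finset.sdiff_subset_sdiff hT.1 le_rfl
    · intro T hT
      simp only [Finset.mem_filter, Finset.mem_powerset] at hT ⊢
      exact ⟨Finset.union_subset (hT.trans Finset.sdiff_subset) hU, Finset.subset_union_right⟩
    · intro T hT
      simp only [Finset.mem_filter, Finset.mem_powerset] at hT
      exact Finset.sdiff_union_of_subset hT.2
    · intro T hT
      simp only [Finset.mem_powerset, Finset.subset_sdiff] at hT
      rw [Finset.union_sdiff_right, Finset.sdiff_eq_self_of_disjoint hT.2]
    · intro T hT
      simp only [Finset.mem_filter, Finset.mem_powerset] at hT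
      rw [Finset.sdiff_union_of_subset hT.2]
  · intro T U
    simp only [Finset.mem_powerset, Finset.mem_filter]
    constructor
    · rintro ⟨h1, h2⟩; exact ⟨⟨h1, h2⟩, h2.trans h1⟩
    · rintro ⟨⟨h1, h2⟩, _⟩; exact ⟨h1, h2⟩

/-- The inverse of `posMoment D η` for the convolution of functions of finite sets. -/
def posCoeff (D : Measure (Vec d)) (η : ι → Fin d) : Finset ι → ℝ
  | S => (if S = ∅ then 1 else 0) -
      ∑ T : {T // T ∈ S.powerset.erase ∅}, posMoment D η T.1 * posCoeff D η (S \ T.1)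
  termination_by S => S.card
  decreasing_by
    have h := T.2
    simp only [Finset.mem_erase, Finset.mem_powerset] at h
    exact Finset.card_lt_card
      (Finset.sdiff_ssubset h.2 (Finset.nonempty_iff_ne_empty.2 h.1))

/-- The adjusted polynomial in the positions `S`, at the multi-index `η`. -/
def posPoly (D : Measure (Vec d)) (η : ι → Fin d) (S : Finset ι) (x : Vec d) : ℝ :=
  ∑ T ∈ S.powerset, posCoeff D η (S \ T) * ∏ j ∈ T, x (η j)

variable (D : Measure (Vec d)) (η : ι → Fin d)

theorem sum_posMoment_mul_posCoeff [IsProbabilityMeasure D] (S : Finset ι) :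
    ∑ T ∈ S.powerset, posMoment D η T * posCoeff D η (S \ T) = if S = ∅ then 1 else 0 := by
  rw [← Finset.add_sum_erase _ _ (Finset.empty_mem_powerset S), posMoment_empty,
    Finset.sdiff_empty, one_mul]
  nth_rewrite 1 [posCoeff]
  rw [Finset.sum_coe_sort (S.powerset.erase ∅)
    (fun T => posMoment D η T * posCoeff D η (S \ T))]
  ring

theorem posCoeff_empty [IsProbabilityMeasure D] : posCoeff D η ∅ = 1 := by
  have h := sum_posMoment_mul_posCoeff D η (∅ : Finset ι)
  simpa [posMoment_empty] using h

theorem posPoly_empty [IsProbabilityMeasure D] (x : Vec d) : posPoly D η ∅ x = 1 := by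
  simp [posPoly, posCoeff_empty]

/-- Convolving the moments with their inverse cancels, leaving only the monomial with `U = S`. This
is the defining recursion of the adjusted polynomials in solved form. -/
theorem sum_posMoment_mul_posPoly [IsProbabilityMeasure D] (S : Finset ι) (x : Vec d) :
    ∑ T ∈ S.powerset, posMoment D η T * posPoly D η (S \ T) x = ∏ j ∈ S, x (η j) := by
  simp only [posPoly, Finset.mul_sum]
  rw [sum_powerset_sdiff_comm]
  rw [Finset.sum_eq_single_of_mem S (Finset.mem_powerset_self S)]
  · simp [posMoment_empty, posCoeff_empty]
  · intro U hU hne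
    have h : ∀ T ∈ (S \ U).powerset,
        posMoment D η T * (posCoeff D η ((S \ T) \ U) * ∏ j ∈ U, x (η j)) =
          (posMoment D η T * posCoeff D η ((S \ U) \ T)) * ∏ j ∈ U, x (η j) := by
      intro T _
      rw [sdiff_right_comm]; ring
    rw [Finset.sum_congr rfl h, ← Finset.sum_mul, sum_posMoment_mul_posCoeff, if_neg, zero_mul]
    rw [Finset.sdiff_eq_empty_iff_subset]
    exact fun h => hne (Finset.Subset.antisymm (Finset.mem_powerset.1 hU) h)

theorem posPoly_eq_sub [IsProbabilityMeasure D] (S : Finset ι) (x : Vec d) :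
    posPoly D η S x = ∏ j ∈ S, x (η j) -
      ∑ T ∈ S.powerset.erase ∅, posMoment D η T * posPoly D η (S \ T) x := by
  rw [← sum_posMoment_mul_posPoly D η S x,
    ← Finset.add_sum_erase _ _ (Finset.empty_mem_powerset S), posMoment_empty,
    Finset.sdiff_empty, one_mul]
  ring

/-- Appell property: the shift expands each monomial, and the coefficients `posCoeff` depend only on
the complement, so they regroup into adjusted polynomials in the remaining positions. -/
theorem posPoly_add (S : Finset ι) (x a : Vec d) :
    posPoly D η S (x + a) = ∑ U ∈ S.powerset, (∏ j ∈ U, a (η j)) * posPoly D η (S \ U) x := by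
  simp only [posPoly, PiLp.add_apply, Finset.prod_add, Finset.mul_sum]
  have h : ∀ T ∈ S.powerset, ∑ i ∈ T.powerset, posCoeff D η (S \ T) *
        ((∏ j ∈ i, x (η j)) * ∏ j ∈ T \ i, a (η j)) =
      ∑ i ∈ T.powerset, posCoeff D η (S \ T) *
        ((∏ j ∈ T \ i, x (η j)) * ∏ j ∈ i, a (η j)) := by
    intro T _
    refine Finset.sum_bij' (fun U _ => T \ U) (fun U _ => T \ U) ?_ ?_ ?_ ?_ ?_
    · intro U _; simp
    · intro U _; simp
    · intro U hU; simp [Finset.inter_eq_right.2 (Finset.mem_powerset.1 hU)]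
    · intro U hU; simp [Finset.inter_eq_right.2 (Finset.mem_powerset.1 hU)]
    · intro U hU; simp [Finset.inter_eq_right.2 (Finset.mem_powerset.1 hU)]
  rw [Finset.sum_congr rfl h, sum_powerset_powerset]
  refine Finset.sum_congr rfl fun U _ => Finset.sum_congr rfl fun T hT => ?_
  simp only [Finset.mem_powerset, Finset.subset_sdiff] at hT
  rw [Finset.union_sdiff_right, Finset.sdiff_eq_self_of_disjoint hT.2, Finset.union_comm T U,
    ← Finset.sup_eq_union, ← sdiff_sdiff_left]
  ring

/-- The infinitesimal form of the Appell property. It makes induction on the number of positions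
compatible with the Poincaré inequality. -/
theorem hasFDerivAt_posPoly (S : Finset ι) (x : Vec d) :
    HasFDerivAt (posPoly D η S)
      (∑ j ∈ S, posPoly D η (S.erase j) x • (EuclideanSpace.proj (η j) : Vec d →L[ℝ] ℝ)) x := by
  have h1 : ∀ T : Finset ι, HasFDerivAt (fun x : Vec d => ∏ j ∈ T, x (η j))
      (∑ j ∈ T, (∏ i ∈ T.erase j, x (η i)) • (EuclideanSpace.proj (η j) : Vec d →L[ℝ] ℝ)) x := by
    intro T
    exact HasFDerivAt.finsetProd fun j _ =>
      (EuclideanSpace.proj (η j) : Vec d →L[ℝ] ℝ).hasFDerivAt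
  have h2 : HasFDerivAt (posPoly D η S) (∑ T ∈ S.powerset, posCoeff D η (S \ T) •
      ∑ j ∈ T, (∏ i ∈ T.erase j, x (η i)) • (EuclideanSpace.proj (η j) : Vec d →L[ℝ] ℝ)) x :=
    HasFDerivAt.fun_sum fun T _ => (h1 T).const_mul _
  convert h2 using 1
  simp only [Finset.smul_sum, posPoly, Finset.sum_smul]
  symm
  rw [Finset.sum_comm' (t' := S) (s' := fun j => S.powerset.filter (j ∈ ·))]
  · refine Finset.sum_congr rfl fun j hj => ?_
    refine Finset.sum_bij' (fun T _ => T.erase j) (fun T _ => insert j T) ?_ ?_ ?_ ?_ ?_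
    · intro T hT
      simp only [Finset.mem_filter, Finset.mem_powerset] at hT ⊢
      exact Finset.erase_subset_erase _ hT.1
    · intro T hT
      simp only [Finset.mem_filter, Finset.mem_powerset] at hT ⊢
      exact ⟨Finset.insert_subset hj (hT.trans (Finset.erase_subset _ _)),
        Finset.mem_insert_self _ _⟩
    · intro T hT
      exact Finset.insert_erase (Finset.mem_filter.1 hT).2
    · intro T hT
      apply Finset.erase_insert
      intro h
      exact Finset.notMem_erase j S (Finset.mem_powerset.1 hT h)
    · intro T hT
      simp only [Finset.mem_filter, Finset.mem_powerset] at hT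
      rw [smul_smul]
      congr 3
      ext i
      simp only [Finset.mem_sdiff, Finset.mem_erase]
      by_cases hi : i = j
      · subst hi; simp [hT.2]
      · simp [hi]
  · intro T j
    simp only [Finset.mem_powerset, Finset.mem_filter]
    constructor
    · rintro ⟨h1, h2⟩; exact ⟨⟨h1, h2⟩, h1 h2⟩
    · rintro ⟨⟨h1, h2⟩, _⟩; exact ⟨h1, h2⟩

theorem continuous_posPoly (S : Finset ι) : Continuous (posPoly D η S) := by
  unfold posPoly; fun_prop

/-- Both sides obey the same recursion. Arbitrary embeddings are allowed because the recursion
renumbers the positions of a complement, and the induction hypothesis has to apply after that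
renumbering. -/
theorem adjPoly_comp_eq_posPoly [IsProbabilityMeasure D] (x : Vec d) (n : ℕ) :
    ∀ f : Fin n ↪ ι, adjPoly D x n (η ∘ f) = posPoly D η (Finset.univ.map f) x := by
  induction n using Nat.strong_induction_on with
  | _ n ih =>
    intro f
    rw [adjPoly, posPoly_eq_sub]
    have h0 : tensorPow x n (η ∘ f) = ∏ j ∈ Finset.univ.map f, x (η j) := by
      simp [tensorPow]
    beta_reduce
    rw [h0]
    congr 1
    · refine Finset.sum_bij (fun S _ => S.1.map f) ?_ ?_ ?_ ?_
      · intro S _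
        simp only [Finset.mem_erase, Finset.mem_powerset, ne_eq, Finset.map_eq_empty]
        exact ⟨Finset.nonempty_iff_ne_empty.1 S.2, Finset.map_subset_map.2 (Finset.subset_univ _)⟩
      · intro S _ S' _ h
        exact Subtype.ext (Finset.map_injective f h)
      · intro T hT
        simp only [Finset.mem_erase, Finset.mem_powerset] at hT
        obtain ⟨u, _, rfl⟩ := Finset.subset_map_iff.1 hT.2
        exact ⟨⟨u, Finset.nonempty_iff_ne_empty.2 fun h => hT.1 (by simp [h])⟩,
          Finset.mem_univ _, rfl⟩
      · intro S _
        have hcard : S.1ᶜ.card < n := by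
          have h := S.2.card_pos
          have h' := Finset.card_add_card_compl S.1
          rw [Fintype.card_fin] at h'
          omega
        congr 1
        · simp only [place, momentTensor, posMoment, tensorPow, Finset.prod_map]
          congr 1; ext z
          conv_rhs => rw [← Finset.map_orderEmbOfFin_univ S.1 rfl, Finset.prod_map]
          rfl
        · have h := ih _ hcard ((S.1ᶜ.orderEmbOfFin rfl).toEmbedding.trans f)
          rw [place]
          refine Eq.trans ?_ (h.trans ?_)
          · rfl
          · rw [← Finset.map_map, Finset.map_orderEmbOfFin_univ, ← Finset.map_sdiff]
            rw [Finset.compl_eq_univ_sdiff]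

theorem place_adjPoly_eq_posPoly [IsProbabilityMeasure D] {t : ℕ} (η : Fin t → Fin d) (x : Vec d)
    (S : Finset (Fin t)) : place S (adjPoly D x S.card) η = posPoly D η S x := by
  have h := adjPoly_comp_eq_posPoly D η x S.card (S.orderEmbOfFin rfl).toEmbedding
  rw [Finset.map_orderEmbOfFin_univ] at h
  exact h

end Adjusted

/-! ### Moments of Poincaré distributions -/

section Poincare

variable {d : ℕ} {D : Measure (Vec d)}

theorem enorm_gradient_sq (f : Vec d → ℝ) (z : Vec d) :
    ‖∇ f z‖ₑ ^ 2 =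
      ENNReal.ofReal (∑ a, (fderiv ℝ f z (EuclideanSpace.single a (1 : ℝ))) ^ 2) := by
  have h : ∀ a, (∇ f z) a = fderiv ℝ f z (EuclideanSpace.single a (1 : ℝ)) := by
    intro a
    have h1 : inner ℝ (∇ f z) (EuclideanSpace.single a (1 : ℝ)) =
        fderiv ℝ f z (EuclideanSpace.single a (1 : ℝ)) := by
      rw [gradient, InnerProductSpace.toDual_symm_apply]
    rw [← h1, EuclideanSpace.inner_single_right]
    simp
  rw [← ofReal_norm, ← ENNReal.ofReal_pow (norm_nonneg _), EuclideanSpace.real_norm_sq_eq]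
  simp_rw [h]

/-- Bootstrapping: the gradient of the next power is a multiple of the present one, so the Poincaré
inequality makes its extended variance finite, and finite `evariance` already entails square
integrability. -/
theorem IsPoincare.memLp_coord_pow [IsProbabilityMeasure D] (hD : IsPoincare 1 D) (a : Fin d)
    (m : ℕ) : MemLp (fun z : Vec d => z a ^ m) 2 D := by
  induction m with
  | zero => simpa using memLp_const (1 : ℝ)
  | succ m ih =>
    have hd : ∀ z : Vec d, HasFDerivAt (fun z : Vec d => z a ^ (m + 1))
        (((m + 1 : ℕ) * z a ^ m) • (EuclideanSpace.proj a : Vec d →L[ℝ] ℝ)) z := by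
      intro z
      simpa using ((EuclideanSpace.proj a : Vec d →L[ℝ] ℝ).hasFDerivAt (x := z)).pow (m + 1)
    refine (evariance_lt_top_iff_memLp (by fun_prop)).1
      ((hD _ fun z => (hd z).differentiableAt).trans_lt ?_)
    simp only [one_pow, ENNReal.ofReal_one, one_mul]
    have h2 := ((ih.const_mul ((m + 1 : ℕ) : ℝ)).integrable_sq).hasFiniteIntegral
    rw [hasFiniteIntegral_iff_enorm] at h2
    refine lt_of_le_of_lt (lintegral_mono fun z => ?_) h2
    rw [enorm_gradient_sq, (hd z).fderiv, ← ofReal_norm]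
    refine ENNReal.ofReal_le_ofReal (le_of_eq ?_)
    rw [Real.norm_of_nonneg (sq_nonneg _), Finset.sum_eq_single a]
    · simp
    · intro b _ hb
      simp [hb.symm]
    · simp

/-- Uses `|a b| ≤ a² + b²`. The exponent stays general because each new factor doubles it in the
induction hypothesis. -/
theorem IsPoincare.memLp_prod_pow [IsProbabilityMeasure D] (hD : IsPoincare 1 D) {ι : Type*}
    (η : ι → Fin d) (T : Finset ι) (m : ℕ) :
    MemLp (fun z : Vec d => (∏ j ∈ T, z (η j)) ^ m) 2 D := by
  classical
  induction T using Finset.induction_on generalizing m with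
  | empty => simpa using memLp_const (1 : ℝ)
  | insert j T hj ih =>
    refine ((hD.memLp_coord_pow (η j) (2 * m)).add (ih (2 * m))).mono (by fun_prop) ?_
    refine Filter.Eventually.of_forall fun z => ?_
    rw [Finset.prod_insert hj, Pi.add_apply, pow_mul', pow_mul',
      mul_pow, Real.norm_eq_abs, Real.norm_eq_abs, abs_mul,
      abs_of_nonneg (add_nonneg (sq_nonneg (z (η j) ^ m)) (sq_nonneg ((∏ j ∈ T, z (η j)) ^ m))),
      ← sq_abs, ← sq_abs ((∏ j ∈ T, z (η j)) ^ m)]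
    nlinarith [sq_nonneg (|z (η j) ^ m| - |(∏ j ∈ T, z (η j)) ^ m|),
      mul_nonneg (abs_nonneg (z (η j) ^ m)) (abs_nonneg ((∏ j ∈ T, z (η j)) ^ m))]

theorem IsPoincare.integrable_prod [IsProbabilityMeasure D] (hD : IsPoincare 1 D) {ι : Type*}
    (η : ι → Fin d) (T : Finset ι) : Integrable (fun z : Vec d => ∏ j ∈ T, z (η j)) D := by
  simpa using (hD.memLp_prod_pow η T 1).integrable one_le_two

variable {ι : Type*} [DecidableEq ι]

theorem IsPoincare.integrable_posPoly [IsProbabilityMeasure D] (hD : IsPoincare 1 D)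
    (η : ι → Fin d) (S : Finset ι) : Integrable (posPoly D η S) D :=
  integrable_finsetSum _ fun T _ => (hD.integrable_prod η T).const_mul _

theorem IsPoincare.integral_posPoly [IsProbabilityMeasure D] (hD : IsPoincare 1 D)
    (η : ι → Fin d) (S : Finset ι) : ∫ z, posPoly D η S z ∂D = if S = ∅ then 1 else 0 := by
  rw [← sum_posMoment_mul_posCoeff D η S]
  simp only [posPoly]
  rw [integral_finsetSum _ fun T _ => (hD.integrable_prod η T).const_mul _]
  refine Finset.sum_congr rfl fun T _ => ?_
  rw [integral_const_mul, mul_comm, posMoment]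

theorem IsPoincare.lintegral_sq_le [IsProbabilityMeasure D] (hD : IsPoincare 1 D)
    {f : Vec d → ℝ} (hf : Differentiable ℝ f) (h0 : ∫ z, f z ∂D = 0) :
    ∫⁻ z, ENNReal.ofReal (f z ^ 2) ∂D ≤
      ∫⁻ z, ENNReal.ofReal
        (∑ a, (fderiv ℝ f z (EuclideanSpace.single a (1 : ℝ))) ^ 2) ∂D := by
  have h := hD f hf
  simp only [evariance_eq_lintegral_ofReal, h0, sub_zero, one_pow, ENNReal.ofReal_one, one_mul,
    enorm_gradient_sq] at h
  exact h

end Poincare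

/-! ### Integrating out coordinates of a product measure -/

theorem lintegral_lmarginal {κ : Type*} [Fintype κ] [DecidableEq κ] {X : κ → Type*}
    [∀ i, MeasurableSpace (X i)] (ν : ∀ i, Measure (X i)) [∀ i, IsProbabilityMeasure (ν i)]
    {f : (∀ i, X i) → ℝ≥0∞} (hf : Measurable f) (s : Finset κ) :
    ∫⁻ y, lmarginal ν s f y ∂Measure.pi ν = ∫⁻ y, f y ∂Measure.pi ν := by
  obtain ⟨x⟩ := (Measure.pi ν).nonempty_of_neZero
  -- The marginal no longer depends on the coordinates in `s`, so averaging over them again changes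
  -- nothing.
  have hg : lmarginal ν s (lmarginal ν s f) = lmarginal ν s f := by
    ext y
    conv_lhs => rw [lmarginal]
    have h : ∀ z : (∀ i : s, X i), lmarginal ν s f (Function.updateFinset y s z) =
        lmarginal ν s f y := fun z =>
      lmarginal_congr _ _ fun i hi => by simp [Function.updateFinset, hi]
    simp [h]
  have hu : (Finset.univ : Finset κ) = sᶜ ∪ s := by rw [Finset.union_comm, Finset.union_compl]
  rw [lintegral_eq_lmarginal_univ x, lintegral_eq_lmarginal_univ x, hu,
    lmarginal_union _ _ hf disjoint_compl_left,
    lmarginal_union _ _ (hf.lmarginal _) disjoint_compl_left, hg]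

/-- Resampling one coordinate preserves the integral; this lets inequalities in a single sample be
used under the joint law. -/
theorem lintegral_pi_update {κ : Type*} [Fintype κ] [DecidableEq κ] {X : κ → Type*}
    [∀ i, MeasurableSpace (X i)] (ν : ∀ i, Measure (X i)) [∀ i, IsProbabilityMeasure (ν i)]
    {f : (∀ i, X i) → ℝ≥0∞} (hf : Measurable f) (i : κ) :
    ∫⁻ y, ∫⁻ x, f (Function.update y i x) ∂ν i ∂Measure.pi ν = ∫⁻ y, f y ∂Measure.pi ν := by
  rw [← lintegral_lmarginal ν hf {i}, lmarginal_singleton f i]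

/-! ### Products of adjusted polynomials in independent samples -/

section Block

variable {d m : ℕ} {ι : Type*} [DecidableEq ι]

/-- The product of `μ` in the positions of `S` with label `none` and of the adjusted polynomials
of `y i` in the positions with label `i`. -/
def blockPoly (D : Measure (Vec d)) (μ : Vec d) (p : ι → Option (Fin m)) (S : Finset ι)
    (η : ι → Fin d) (y : Fin m → Vec d) : ℝ :=
  (∏ j ∈ S.filter (p · = none), μ (η j)) *
    ∏ i, posPoly D η (S.filter (p · = some i)) (y i)

variable {D : Measure (Vec d)} {μ : Vec d} {p : ι → Option (Fin m)}

theorem continuous_blockPoly (S : Finset ι) (η : ι → Fin d) :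
    Continuous (blockPoly D μ p S η) := by
  unfold blockPoly
  have := fun S => continuous_posPoly D η S
  fun_prop

theorem blockPoly_update (S : Finset ι) (η : ι → Fin d) (y : Fin m → Vec d) (i : Fin m)
    (x : Vec d) : blockPoly D μ p S η (Function.update y i x) =
      ((∏ j ∈ S.filter (p · = none), μ (η j)) *
        ∏ i' ∈ Finset.univ.erase i, posPoly D η (S.filter (p · = some i')) (y i')) *
      posPoly D η (S.filter (p · = some i)) x := by
  rw [blockPoly, ← Finset.prod_erase_mul _ _ (Finset.mem_univ i), Function.update_self, mul_assoc]
  congr 2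
  exact Finset.prod_congr rfl fun i' hi' => by
    rw [Function.update_of_ne (Finset.ne_of_mem_erase hi')]

/-- Has the same prefactor as `blockPoly_update`, so the derivative in sample `i` is again a
combination of block polynomials with one position erased. -/
theorem blockPoly_erase_update (S : Finset ι) (η : ι → Fin d) (y : Fin m → Vec d) (i : Fin m)
    (x : Vec d) {j : ι} (hj : p j = some i) :
    blockPoly D μ p (S.erase j) η (Function.update y i x) =
      ((∏ j ∈ S.filter (p · = none), μ (η j)) *
        ∏ i' ∈ Finset.univ.erase i, posPoly D η (S.filter (p · = some i')) (y i')) *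
      posPoly D η ((S.filter (p · = some i)).erase j) x := by
  have h : ∀ o, o ≠ some i → (S.erase j).filter (p · = o) = S.filter (p · = o) := by
    intro o ho
    rw [Finset.filter_erase, Finset.erase_eq_of_notMem]
    simp [hj, ho.symm]
  rw [blockPoly_update, h none (by simp), Finset.filter_erase]
  congr 2
  refine Finset.prod_congr rfl fun i' hi' => ?_
  rw [h]
  simpa using Finset.ne_of_mem_erase hi'

theorem blockPoly_erase_none (S : Finset ι) (η : ι → Fin d) (y : Fin m → Vec d)
    {j : ι} (hjS : j ∈ S) (hj : p j = none) :
    blockPoly D μ p S η y = μ (η j) * blockPoly D μ p (S.erase j) η y := by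
  have h : ∀ i : Fin m, (S.erase j).filter (p · = some i) = S.filter (p · = some i) := by
    intro o
    rw [Finset.filter_erase, Finset.erase_eq_of_notMem]
    simp [hj]
  simp only [blockPoly, h, Finset.filter_erase]
  rw [← Finset.mul_prod_erase (S.filter (p · = none)) _ (by simp [hjS, hj] : j ∈ _), mul_assoc]

theorem lintegral_ofReal_const_mul_sum_le {Ω κ : Type*} [MeasurableSpace Ω] {P : Measure Ω}
    (s : Finset κ) {f : κ → Ω → ℝ} (hf : ∀ k, Measurable (f k)) {c : ℝ} (hc : 0 ≤ c) {b : κ → ℝ}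
    (hb : ∀ k, 0 ≤ b k)
    (h : ∀ k ∈ s, ∫⁻ ω, ENNReal.ofReal (f k ω ^ 2) ∂P ≤ ENNReal.ofReal (b k)) :
    ∫⁻ ω, ENNReal.ofReal (c * ∑ k ∈ s, f k ω ^ 2) ∂P ≤ ENNReal.ofReal (c * ∑ k ∈ s, b k) := by
  simp_rw [ENNReal.ofReal_mul hc]
  rw [lintegral_const_mul _ (by fun_prop)]
  gcongr
  rw [ENNReal.ofReal_sum_of_nonneg fun k _ => hb k]
  simp_rw [ENNReal.ofReal_sum_of_nonneg fun k (_ : k ∈ s) => sq_nonneg (f k _)]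
  rw [lintegral_finsetSum _ (fun k _ => by fun_prop)]
  exact Finset.sum_le_sum h

/-- The part of the tensor `v` with `a` in position `j`. -/
def slice (v : (ι → Fin d) → ℝ) (j : ι) (a : Fin d) (η : ι → Fin d) : ℝ :=
  if η j = a then v η else 0

theorem slice_support {v : (ι → Fin d) → ℝ} {η₀ : ι → Fin d} {S : Finset ι}
    (hv : ∀ η, v η ≠ 0 → ∀ j ∉ S, η j = η₀ j) (j : ι) (a : Fin d) (η : ι → Fin d)
    (hη : slice v j a η ≠ 0) : ∀ i ∉ S.erase j, η i = Function.update η₀ j a i := by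
  intro i hi
  simp only [slice, ne_eq, ite_eq_right_iff, Classical.not_imp] at hη
  by_cases hij : i = j
  · subst hij; simp [hη.1]
  · rw [Function.update_of_ne hij]
    exact hv η hη.2 i fun h => hi (Finset.mem_erase.2 ⟨hij, h⟩)

variable [Fintype ι]

theorem sum_slice_mul (v g : (ι → Fin d) → ℝ) (j : ι) (h : Fin d → ℝ) :
    ∑ a, h a * ∑ η, slice v j a η * g η = ∑ η, v η * (h (η j) * g η) := by
  simp only [Finset.mul_sum]
  rw [Finset.sum_comm]
  refine Finset.sum_congr rfl fun η _ => ?_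
  rw [Finset.sum_eq_single (η j)]
  · simp [slice]; ring
  · intro b _ hb; simp [slice, hb.symm]
  · simp

/-- The slices have disjoint supports. Hence summing over directions costs no factor `d`. -/
theorem sum_slice_sq (v : (ι → Fin d) → ℝ) (j : ι) :
    ∑ a, ∑ η, slice v j a η ^ 2 = ∑ η, v η ^ 2 := by
  rw [Finset.sum_comm]
  refine Finset.sum_congr rfl fun η _ => ?_
  simp [slice]

/-- Each round removes one position, either by Cauchy–Schwarz against `μ` (cost `K`) or by the
Poincaré inequality in one sample (cost at most `(n + 1)²`). The reference index `η₀` records that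
`v` is effectively a tensor in the positions of `S` alone: slicing freezes a position, and the base
case is a single entry. -/
theorem IsPoincare.lintegral_sum_blockPoly_sq_le [IsProbabilityMeasure D] (hD : IsPoincare 1 D)
    {K : ℝ} (hK : 1 ≤ K) (hμ : ∑ a, μ a ^ 2 ≤ K) (n : ℕ) :
    ∀ (S : Finset ι) (v : (ι → Fin d) → ℝ) (η₀ : ι → Fin d), S.card = n →
      (∀ η, v η ≠ 0 → ∀ j ∉ S, η j = η₀ j) →
      ∫⁻ y, ENNReal.ofReal ((∑ η, v η * blockPoly D μ p S η y) ^ 2)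
          ∂(Measure.pi fun _ : Fin m => D) ≤
        ENNReal.ofReal ((n.factorial : ℝ) ^ 2 * K ^ n * ∑ η, v η ^ 2) := by
  have hK0 : 0 ≤ K := zero_le_one.trans hK
  induction n with
  | zero =>
    intro S v η₀ hS hv
    obtain rfl := Finset.card_eq_zero.1 hS
    have hv' : ∀ η, η ≠ η₀ → v η = 0 := by
      intro η hη
      by_contra h
      exact hη (funext fun j => hv η h j (Finset.notMem_empty j))
    have h1 : ∀ y : Fin m → Vec d, ∑ η, v η * blockPoly D μ p ∅ η y = v η₀ := by
      intro y
      rw [Finset.sum_eq_single η₀ (fun η _ hη => by simp [hv' η hη]) (by simp)]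
      simp [blockPoly, posPoly_empty]
    simp only [h1]
    rw [Finset.sum_eq_single η₀ (fun η _ hη => by simp [hv' η hη]) (by simp)]
    simp
  | succ n ih =>
    intro S v η₀ hS hv
    have hB : (0 : ℝ) ≤ (n.factorial : ℝ) ^ 2 * K ^ n := by positivity
    have hmeas : ∀ (S : Finset ι) (v : (ι → Fin d) → ℝ),
        Measurable fun y => ∑ η, v η * blockPoly D μ p S η y := fun S v =>
      Finset.measurable_fun_sum _ fun η _ => (continuous_blockPoly S η).measurable.const_mul _
    have hslice : ∀ j ∈ S, ∀ a, ∫⁻ y, ENNReal.ofReal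
        ((∑ η, slice v j a η * blockPoly D μ p (S.erase j) η y) ^ 2)
          ∂(Measure.pi fun _ : Fin m => D) ≤
        ENNReal.ofReal ((n.factorial : ℝ) ^ 2 * K ^ n * ∑ η, slice v j a η ^ 2) := by
      intro j hj a
      exact ih _ _ _ (by rw [Finset.card_erase_of_mem hj, hS]; rfl) (slice_support hv j a)
    by_cases hnone : ∃ j ∈ S, p j = none
    · obtain ⟨j, hjS, hj⟩ := hnone
      have h1 : ∀ y, (∑ η, v η * blockPoly D μ p S η y) ^ 2 ≤
          K * ∑ a, (∑ η, slice v j a η * blockPoly D μ p (S.erase j) η y) ^ 2 := by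
        intro y
        simp only [blockPoly_erase_none S _ y hjS hj]
        rw [← sum_slice_mul v (fun η => blockPoly D μ p (S.erase j) η y) j (fun a => μ a)]
        refine (Finset.sum_mul_sq_le_sq_mul_sq _ _ _).trans ?_
        gcongr
      refine (lintegral_mono fun y => ENNReal.ofReal_le_ofReal (h1 y)).trans ?_
      refine (lintegral_ofReal_const_mul_sum_le _ (fun a => hmeas _ _) hK0
        (fun a => mul_nonneg hB (Finset.sum_nonneg fun η _ => sq_nonneg _))
        (fun a _ => hslice j hjS a)).trans ?_
      rw [← Finset.mul_sum, sum_slice_sq]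
      apply ENNReal.ofReal_le_ofReal
      have hf : (n.factorial : ℝ) ≤ ((n + 1).factorial : ℝ) :=
        Nat.cast_le.2 (Nat.factorial_le n.le_succ)
      have : 0 ≤ ∑ η, v η ^ 2 := Finset.sum_nonneg fun η _ => sq_nonneg _
      calc K * ((n.factorial : ℝ) ^ 2 * K ^ n * ∑ η, v η ^ 2)
          = (n.factorial : ℝ) ^ 2 * K ^ (n + 1) * ∑ η, v η ^ 2 := by ring
        _ ≤ _ := by gcongr
    -- No position carries `μ`, so some sample `i` occupies a nonempty set `Si` of positions and the
    -- form has mean zero in that sample.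
    · push Not at hnone
      obtain ⟨j₀, hj₀⟩ : S.Nonempty := Finset.card_pos.1 (by omega)
      obtain ⟨i, hi⟩ := Option.ne_none_iff_exists'.1 (hnone j₀ hj₀)
      set Si := S.filter (p · = some i) with hSi
      have hSine : Si ≠ ∅ := Finset.ne_empty_of_mem (Finset.mem_filter.2 ⟨hj₀, hi⟩)
      have hcard : (Si.card : ℝ) ≤ n + 1 := by
        have h := Finset.card_filter_le S (p · = some i)
        rw [hS] at h
        exact_mod_cast h
      set h : ι × Fin d → (Fin m → Vec d) → ℝ := fun q y =>
        ∑ η, slice v q.1 q.2 η * blockPoly D μ p (S.erase q.1) η y with hh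
      have hhm : ∀ q, Measurable (h q) := fun q => hmeas _ _
      -- Poincaré in sample `i`. Each partial derivative is a sum over `j ∈ Si`, so squaring it
      -- costs a factor `Si.card`; adding up the slices over `j` later gives a second one.
      have key : ∀ y, ∫⁻ x, ENNReal.ofReal
          ((∑ η, v η * blockPoly D μ p S η (Function.update y i x)) ^ 2) ∂D ≤
          ∫⁻ x, ENNReal.ofReal
            (Si.card * ∑ q ∈ Si ×ˢ Finset.univ, h q (Function.update y i x) ^ 2) ∂D := by
        intro y
        set Cf : (ι → Fin d) → ℝ := fun η => (∏ j ∈ S.filter (p · = none), μ (η j)) *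
          ∏ i' ∈ Finset.univ.erase i, posPoly D η (S.filter (p · = some i')) (y i') with hCf
        have hG : ∀ x, ∑ η, v η * blockPoly D μ p S η (Function.update y i x) =
            ∑ η, v η * Cf η * posPoly D η Si x := fun x =>
          Finset.sum_congr rfl fun η _ => by rw [blockPoly_update, ← mul_assoc]
        have hder : ∀ x, HasFDerivAt (fun x => ∑ η, v η * Cf η * posPoly D η Si x)
            (∑ η, (v η * Cf η) • ∑ j ∈ Si, posPoly D η (Si.erase j) x •
              (EuclideanSpace.proj (η j) : Vec d →L[ℝ] ℝ)) x := fun x =>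
          HasFDerivAt.fun_sum fun η _ => (hasFDerivAt_posPoly D η Si x).const_mul _
        have hint : ∫ x, ∑ η, v η * Cf η * posPoly D η Si x ∂D = 0 := by
          rw [integral_finsetSum _ fun η _ => (hD.integrable_posPoly η Si).const_mul _]
          refine Finset.sum_eq_zero fun η _ => ?_
          rw [integral_const_mul, hD.integral_posPoly, if_neg hSine, mul_zero]
        simp only [hG]
        refine (hD.lintegral_sq_le (fun x => (hder x).differentiableAt) hint).trans ?_
        refine lintegral_mono fun x => ENNReal.ofReal_le_ofReal ?_
        have hpart : ∀ a, fderiv ℝ (fun x => ∑ η, v η * Cf η * posPoly D η Si x) x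
            (EuclideanSpace.single a (1 : ℝ)) = ∑ j ∈ Si, h (j, a) (Function.update y i x) := by
          intro a
          rw [(hder x).fderiv]
          simp only [_root_.sum_apply, _root_.smul_apply, hh,
            Finset.smul_sum]
          rw [Finset.sum_comm]
          refine Finset.sum_congr rfl fun j hj => Finset.sum_congr rfl fun η _ => ?_
          rw [blockPoly_erase_update _ _ _ _ _ (Finset.mem_filter.1 hj).2]
          by_cases ha : η j = a
          · simp [slice, ha, hCf, hSi]; ring
          · simp [slice, ha]
        simp only [hpart]
        rw [Finset.sum_product_right, Finset.mul_sum]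
        exact Finset.sum_le_sum fun a _ => sq_sum_le_card_mul_sum_sq
      rw [← lintegral_pi_update (fun _ : Fin m => D) (by
        have := hmeas S v
        fun_prop) i]
      refine (lintegral_mono key).trans ?_
      rw [lintegral_pi_update (fun _ : Fin m => D) (f := fun y => ENNReal.ofReal
        (Si.card * ∑ q ∈ Si ×ˢ Finset.univ, h q y ^ 2)) (by fun_prop) i]
      refine (lintegral_ofReal_const_mul_sum_le _ hhm (Nat.cast_nonneg _)
        (b := fun q => (n.factorial : ℝ) ^ 2 * K ^ n * ∑ η, slice v q.1 q.2 η ^ 2)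
        (fun q => mul_nonneg hB (Finset.sum_nonneg fun η _ => sq_nonneg _)) ?_).trans ?_
      · intro q hq
        exact hslice _ (Finset.mem_filter.1 (Finset.mem_product.1 hq).1).1 _
      · rw [Finset.sum_product]
        simp only [← Finset.mul_sum, sum_slice_sq, Finset.sum_const, nsmul_eq_mul]
        apply ENNReal.ofReal_le_ofReal
        have : 0 ≤ ∑ η, v η ^ 2 := Finset.sum_nonneg fun η _ => sq_nonneg _
        calc (Si.card : ℝ) * ((n.factorial : ℝ) ^ 2 * K ^ n * (Si.card * ∑ η, v η ^ 2))
            ≤ ((n : ℝ) + 1) * ((n.factorial : ℝ) ^ 2 * K ^ n * (((n : ℝ) + 1) * ∑ η, v η ^ 2)) := by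
              gcongr
          _ = ((n + 1).factorial : ℝ) ^ 2 * K ^ n * ∑ η, v η ^ 2 := by
              rw [Nat.factorial_succ]; push_cast; ring
          _ ≤ ((n + 1).factorial : ℝ) ^ 2 * K ^ (n + 1) * ∑ η, v η ^ 2 := by
              gcongr
              omega

end Block

/-! ### The estimator: mean and second moment -/

section Estimator

variable {d m : ℕ} {D : Measure (Vec d)}

theorem IsPoincare.integrable_blockPoly [IsProbabilityMeasure D] (hD : IsPoincare 1 D)
    {ι : Type*} [DecidableEq ι] (μ : Vec d) (p : ι → Option (Fin m)) (S : Finset ι)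
    (η : ι → Fin d) : Integrable (blockPoly D μ p S η) (Measure.pi fun _ : Fin m => D) :=
  (Integrable.fintype_prod (f := fun i x => posPoly D η (S.filter (p · = some i)) x)
    fun _ => hD.integrable_posPoly η _).const_mul _

/-- By independence the mean factors, and any sample occupying a position contributes a factor zero.
-/
theorem IsPoincare.integral_blockPoly [IsProbabilityMeasure D] (hD : IsPoincare 1 D)
    {ι : Type*} [DecidableEq ι] (μ : Vec d) (p : ι → Option (Fin m)) (S : Finset ι)
    (η : ι → Fin d) [Decidable (∀ j ∈ S, p j = none)] :
    ∫ y, blockPoly D μ p S η y ∂(Measure.pi fun _ : Fin m => D) =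
      if ∀ j ∈ S, p j = none then ∏ j ∈ S, μ (η j) else 0 := by
  simp only [blockPoly]
  rw [integral_const_mul,
    integral_fintype_prod_eq_prod (fun i x => posPoly D η (S.filter (p · = some i)) x)]
  simp only [hD.integral_posPoly]
  split_ifs with h
  · rw [Finset.filter_true_of_mem h]
    refine (congrArg _ (Finset.prod_eq_one fun i _ => ?_)).trans (mul_one _)
    rw [if_pos]
    exact Finset.filter_false_of_mem fun j hj => by simp [h j hj]
  · push Not at h
    obtain ⟨j, hj, hne⟩ := h
    obtain ⟨i, hi⟩ := Option.ne_none_iff_exists'.1 hne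
    rw [Finset.prod_eq_zero (Finset.mem_univ i), mul_zero]
    rw [if_neg]
    exact Finset.ne_empty_of_mem (Finset.mem_filter.2 ⟨hj, hi⟩)

/-- By `posPoly_add`: shifting sample `i` lets any subset `U` of its positions be taken over by `μ`.
-/
theorem blockPoly_update_add {ι : Type*} [DecidableEq ι] (μ : Vec d) (q : ι → Fin m)
    (S : Finset ι) (η : ι → Fin d) (y : Fin m → Vec d) (i : Fin m) :
    blockPoly D μ (fun j => some (q j)) S η (Function.update y i (y i + μ)) =
      ∑ U ∈ (S.filter (q · = i)).powerset,
        blockPoly D μ (fun j => if j ∈ U then none else some (q j)) S η y := by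
  rw [blockPoly_update, posPoly_add, Finset.mul_sum]
  have h0 : S.filter (fun j => some (q j) = none) = ∅ := by simp
  simp only [h0, Finset.prod_empty, one_mul, Option.some.injEq]
  refine Finset.sum_congr rfl fun U hU => ?_
  have hUS : ∀ j ∈ U, j ∈ S ∧ q j = i := fun j hj =>
    Finset.mem_filter.1 (Finset.mem_powerset.1 hU hj)
  rw [blockPoly, ← Finset.prod_erase_mul Finset.univ _ (Finset.mem_univ i)]
  have h1 : S.filter (fun j => (if j ∈ U then none else some (q j)) = none) = U := by
    ext j
    simp only [Finset.mem_filter]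
    constructor
    · rintro ⟨_, h⟩; by_contra hj; simp [hj] at h
    · intro h; simp [h, hUS j h]
  have h2 : S.filter (fun j => (if j ∈ U then none else some (q j)) = some i) =
      S.filter (q · = i) \ U := by
    ext j
    by_cases hj : j ∈ U <;> simp [hj]
  have h3 : ∀ i' ≠ i, S.filter (fun j => (if j ∈ U then none else some (q j)) = some i') =
      S.filter (q · = i') := by
    intro i' hi'
    ext j
    by_cases hj : j ∈ U
    · simp [hj, (hUS j hj).2, hi'.symm]
    · simp [hj]
  have h4 := Finset.prod_congr rfl fun i' (hi' : i' ∈ Finset.univ.erase i) =>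
    congrArg (fun T => posPoly D η T (y i')) (h3 i' (Finset.ne_of_mem_erase hi'))
  rw [h1, h2, h4]
  ring

/-- The coefficient `(-1)^𝒞 / binom(t-1, 𝒞-1)` of a partition in `Q_t`. -/
def coeffQ {t : ℕ} (p : Fin t → Fin t) : ℝ :=
  (-1 : ℝ) ^ numParts p / ((t - 1).choose (numParts p - 1) : ℝ)

theorem coeffQ_sq_le_one {t : ℕ} (p : Fin t → Fin t) : coeffQ p ^ 2 ≤ 1 := by
  have hc : numParts p - 1 ≤ t - 1 := by
    have : numParts p ≤ t := (Finset.card_le_univ _).trans_eq (Fintype.card_fin t)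
    omega
  have h1 : (1 : ℝ) ≤ ((t - 1).choose (numParts p - 1) : ℝ) := by
    exact_mod_cast Nat.choose_pos hc
  rw [coeffQ, div_pow, ← pow_mul, mul_comm, pow_mul]
  simp only [even_two, Even.neg_pow, one_pow]
  rw [div_le_one (by positivity)]
  nlinarith

/-- The only coefficient of `Q` that matters for its mean; for the variance `coeffQ_sq_le_one`
suffices. -/
theorem coeffQ_const {t : ℕ} (i : Fin t) : coeffQ (fun _ => i) = -1 := by
  have h : numParts (fun _ : Fin t => i) = 1 := by
    rw [numParts, Finset.card_eq_one]
    refine ⟨i, ?_⟩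
    ext k
    simp only [part, Finset.mem_filter, Finset.mem_univ, true_and, Finset.mem_singleton]
    constructor
    · rintro ⟨j, hj⟩; exact (Finset.mem_filter.1 hj).2.symm
    · rintro rfl; exact ⟨k, by simp⟩
  simp [coeffQ, h]

theorem polyQ_eq_sum_blockPoly [IsProbabilityMeasure D] (μ : Vec d) {t : ℕ} (e : Fin t ↪ Fin m)
    (y : Fin m → Vec d) (η : Fin t → Fin d) :
    polyQ D t (fun i => y (e i)) η =
      ∑ p, coeffQ p * blockPoly D μ (fun j => some (e (p j))) Finset.univ η y := by
  simp only [polyQ, coeffQ, place_adjPoly_eq_posPoly, part, blockPoly]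
  refine Finset.sum_congr rfl fun p _ => ?_
  congr 1
  simp only [reduceCtorEq, Finset.filter_false, Finset.prod_empty, one_mul, Option.some.injEq]
  rw [← Finset.prod_subset (Finset.subset_univ (Finset.univ.map e)), Finset.prod_map]
  · simp
  · intro i _ hi
    have : Finset.univ.filter (fun j => e (p j) = i) = ∅ := by
      apply Finset.filter_false_of_mem
      rintro j _ rfl
      exact hi (by simp)
    rw [this, posPoly_empty]

theorem polyQ_update_add [IsProbabilityMeasure D] (μ : Vec d) {t : ℕ} (e : Fin t ↪ Fin m)
    (y : Fin m → Vec d) (i₀ : Fin m) (η : Fin t → Fin d) :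
    polyQ D t (fun i => Function.update y i₀ (y i₀ + μ) (e i)) η =
      ∑ q ∈ (Finset.univ : Finset (Fin t → Fin t)).sigma
          (fun p => (Finset.univ.filter (fun j => e (p j) = i₀)).powerset),
        coeffQ q.1 * blockPoly D μ (fun j => if j ∈ q.2 then none else some (e (q.1 j)))
          Finset.univ η y := by
  rw [polyQ_eq_sum_blockPoly μ e, Finset.sum_sigma]
  refine Finset.sum_congr rfl fun p _ => ?_
  rw [blockPoly_update_add, Finset.mul_sum]

/-- `Q` has at most `t^t · 2^t` terms, one per map `p` and subset `U`. Cauchy–Schwarz over them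
costs that count twice. -/
theorem IsPoincare.lintegral_sum_polyQ_sq_le [IsProbabilityMeasure D] (hD : IsPoincare 1 D)
    {K : ℝ} (hK : 1 ≤ K) {μ : Vec d} (hμ : ∑ a, μ a ^ 2 ≤ K) {t : ℕ} (e : Fin t ↪ Fin m)
    (i₀ : Fin m) (v : (Fin t → Fin d) → ℝ) :
    ∫⁻ y, ENNReal.ofReal ((∑ η, v η *
        polyQ D t (fun i => Function.update y i₀ (y i₀ + μ) (e i)) η) ^ 2)
        ∂(Measure.pi fun _ : Fin m => D) ≤
      ENNReal.ofReal (((t : ℝ) ^ t * 2 ^ t) ^ 2 *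
        ((t.factorial : ℝ) ^ 2 * K ^ t * ∑ η, v η ^ 2)) := by
  set I := (Finset.univ : Finset (Fin t → Fin t)).sigma
          (fun p => (Finset.univ.filter (fun j => e (p j) = i₀)).powerset) with hI
  set X : (Σ _ : Fin t → Fin t, Finset (Fin t)) → (Fin m → Vec d) → ℝ := fun q y =>
    ∑ η, v η * blockPoly D μ (fun j => if j ∈ q.2 then none else some (e (q.1 j)))
          Finset.univ η y with hX
  have hXm : ∀ q, Measurable (X q) := fun q =>
    Finset.measurable_fun_sum _ fun η _ => (continuous_blockPoly _ η).measurable.const_mul _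
  have hIc : (I.card : ℝ) ≤ (t : ℝ) ^ t * 2 ^ t := by
    have h : I.card ≤ t ^ t * 2 ^ t := by
      rw [hI, Finset.card_sigma]
      refine (Finset.sum_le_card_nsmul _ _ (2 ^ t) fun p _ => ?_).trans ?_
      · rw [Finset.card_powerset]
        exact Nat.pow_le_pow_right two_pos
          ((Finset.card_filter_le _ _).trans_eq (Finset.card_fin t))
      · simp
    exact_mod_cast h
  have hle : ∀ y, (∑ η, v η *
      polyQ D t (fun i => Function.update y i₀ (y i₀ + μ) (e i)) η) ^ 2 ≤
      I.card * ∑ q ∈ I, X q y ^ 2 := by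
    intro y
    have h1 : ∑ η, v η * polyQ D t (fun i => Function.update y i₀ (y i₀ + μ) (e i)) η =
        ∑ q ∈ I, coeffQ q.1 * X q y := by
      simp only [polyQ_update_add, Finset.mul_sum, hX]
      rw [Finset.sum_comm]
      exact Finset.sum_congr rfl fun q _ => Finset.sum_congr rfl fun η _ => by ring
    rw [h1]
    refine sq_sum_le_card_mul_sum_sq.trans ?_
    refine mul_le_mul_of_nonneg_left (Finset.sum_le_sum fun q _ => ?_) (Nat.cast_nonneg _)
    rw [mul_pow]
    exact mul_le_of_le_one_left (sq_nonneg _) (coeffQ_sq_le_one _)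
  refine (lintegral_mono fun y => ENNReal.ofReal_le_ofReal (hle y)).trans ?_
  have hv0 : 0 ≤ ∑ η, v η ^ 2 := Finset.sum_nonneg fun η _ => sq_nonneg _
  have hB : 0 ≤ (t.factorial : ℝ) ^ 2 * K ^ t * ∑ η, v η ^ 2 := by positivity
  refine (lintegral_ofReal_const_mul_sum_le I hXm (Nat.cast_nonneg _)
    (b := fun _ => (t.factorial : ℝ) ^ 2 * K ^ t * ∑ η, v η ^ 2) (fun _ => hB) ?_).trans ?_
  · intro q _
    -- A reference index is needed for the block bound; without multi-indices the sum is empty.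
    by_cases hη : Nonempty (Fin t → Fin d)
    · obtain ⟨η₀⟩ := hη
      exact hD.lintegral_sum_blockPoly_sq_le hK hμ t Finset.univ v η₀ (by simp) (by simp)
    · rw [not_nonempty_iff] at hη
      simp [hX]
  · apply ENNReal.ofReal_le_ofReal
    rw [Finset.sum_const, nsmul_eq_mul, ← mul_assoc, ← sq]
    gcongr

theorem IsPoincare.integrable_polyQ [IsProbabilityMeasure D] (hD : IsPoincare 1 D)
    (μ : Vec d) {t : ℕ} (e : Fin t ↪ Fin m) (i₀ : Fin m) (η : Fin t → Fin d) :
    Integrable (fun y => polyQ D t (fun i => Function.update y i₀ (y i₀ + μ) (e i)) η)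
      (Measure.pi fun _ : Fin m => D) := by
  simp only [polyQ_update_add]
  exact integrable_finsetSum _ fun q _ => (hD.integrable_blockPoly μ _ _ η).const_mul _

/-- A term survives only if `μ` fills every position, which forces the partition to put everything
into the part of the shifted sample `i₀`. Positivity of `t` is needed since for `t = 0` no position
would force this. -/
theorem IsPoincare.integral_polyQ [IsProbabilityMeasure D] (hD : IsPoincare 1 D)
    (μ : Vec d) {t : ℕ} (ht : 0 < t) (e : Fin t ↪ Fin m) (i₀ : Fin m) (η : Fin t → Fin d)
    [Decidable (∃ i, e i = i₀)] :
    ∫ y, polyQ D t (fun i => Function.update y i₀ (y i₀ + μ) (e i)) η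
        ∂(Measure.pi fun _ : Fin m => D) =
      if ∃ i, e i = i₀ then - ∏ j, μ (η j) else 0 := by
  classical
  simp only [polyQ_update_add]
  rw [integral_finsetSum _ fun q _ => (hD.integrable_blockPoly μ _ _ η).const_mul _]
  simp only [integral_const_mul, hD.integral_blockPoly]
  have hall : ∀ U : Finset (Fin t), ∀ p : Fin t → Fin t,
      (∀ j ∈ Finset.univ, (if j ∈ U then none else some (e (p j))) = none) ↔ U = Finset.univ := by
    intro U p
    rw [Finset.eq_univ_iff_forall]
    refine forall_congr' fun j => ?_
    by_cases hj : j ∈ U <;> simp [hj]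
  simp only [hall]
  split_ifs with h
  · obtain ⟨i, hi⟩ := h
    rw [Finset.sum_eq_single ⟨fun _ => i, Finset.univ⟩]
    · simp [coeffQ_const]
    · rintro ⟨p, U⟩ hq hne
      simp only [Finset.mem_sigma, Finset.mem_univ, true_and, Finset.mem_powerset] at hq
      rw [if_neg, mul_zero]
      rintro rfl
      apply hne
      have : p = fun _ => i := by
        funext j
        have := (Finset.mem_filter.1 (hq (Finset.mem_univ j))).2
        exact e.injective (this.trans hi.symm)
      rw [this]
    · intro hn
      exact absurd (by simp [hi]) hn
  · refine Finset.sum_eq_zero fun q hq => ?_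
    simp only [Finset.mem_sigma, Finset.mem_univ, true_and, Finset.mem_powerset] at hq
    rw [if_neg, mul_zero]
    intro hU
    rw [hU] at hq
    exact h ⟨_, (Finset.mem_filter.1 (hq (Finset.mem_univ ⟨0, ht⟩))).2⟩

theorem continuous_polyQ [IsProbabilityMeasure D] {t : ℕ} (η : Fin t → Fin d) :
    Continuous fun x : Fin t → Vec d => polyQ D t x η := by
  simp only [polyQ, place_adjPoly_eq_posPoly]
  have := fun S => continuous_posPoly D η S
  fun_prop

theorem continuous_polyR [IsProbabilityMeasure D] {t : ℕ} (η : Fin t → Fin d) :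
    Continuous fun x : Fin (2 * t) → Vec d => polyR D t x η := by
  have h := continuous_polyQ (D := D) η
  unfold polyR
  exact ((h.comp (by fun_prop)).neg).add (h.comp (by fun_prop))

/-- The positions of the arguments of the first copy of `Q_t` in `R_t`. -/
def firstHalf {t m : ℕ} (h : 2 * t = m) : Fin t ↪ Fin m where
  toFun i := Fin.cast h ⟨i, by omega⟩
  inj' i j hij := by simpa [Fin.ext_iff] using hij

/-- The positions of the arguments of the second copy of `Q_t` in `R_t`. -/
def secondHalf {t m : ℕ} (h : 2 * t = m) : Fin t ↪ Fin m where
  toFun i := Fin.cast h ⟨t + i, by omega⟩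
  inj' i j hij := by simpa [Fin.ext_iff] using hij

theorem polyR_cast {t : ℕ} (h : 2 * t = m) (y : Fin m → Vec d) (η : Fin t → Fin d) :
    polyR D t (fun j => y (Fin.cast h j)) η =
      - polyQ D t (fun i => y (firstHalf h i)) η + polyQ D t (fun i => y (secondHalf h i)) η := rfl

theorem IsPoincare.lintegral_sum_polyR_sq_le [IsProbabilityMeasure D] (hD : IsPoincare 1 D)
    {K : ℝ} (hK : 1 ≤ K) {μ : Vec d} (hμ : ∑ a, μ a ^ 2 ≤ K) {t : ℕ} (h : 2 * t = m)
    (i₀ : Fin m) (v : (Fin t → Fin d) → ℝ) :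
    ∫⁻ y, ENNReal.ofReal ((∑ η, v η *
        polyR D t (fun i => Function.update y i₀ (y i₀ + μ) (Fin.cast h i)) η) ^ 2)
        ∂(Measure.pi fun _ : Fin m => D) ≤
      ENNReal.ofReal (4 * (((t : ℝ) ^ t * 2 ^ t) ^ 2 *
        ((t.factorial : ℝ) ^ 2 * K ^ t * ∑ η, v η ^ 2))) := by
  set B := ((t : ℝ) ^ t * 2 ^ t) ^ 2 * ((t.factorial : ℝ) ^ 2 * K ^ t * ∑ η, v η ^ 2) with hBdef
  have hB : 0 ≤ B := by
    have : 0 ≤ ∑ η, v η ^ 2 := Finset.sum_nonneg fun η _ => sq_nonneg _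
    positivity
  set X : Bool → (Fin m → Vec d) → ℝ := fun b y => ∑ η, v η *
    polyQ D t (fun i => Function.update y i₀ (y i₀ + μ)
      (if b then firstHalf h i else secondHalf h i)) η with hX
  have hXm : ∀ b, Measurable (X b) := fun b =>
    Finset.measurable_fun_sum _ fun η _ => Measurable.const_mul
      ((continuous_polyQ η).measurable.comp (by fun_prop)) _
  have hle : ∀ y, (∑ η, v η *
      polyR D t (fun i => Function.update y i₀ (y i₀ + μ) (Fin.cast h i)) η) ^ 2 ≤
      2 * ∑ b, X b y ^ 2 := by
    intro y
    have h1 : ∑ η, v η *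
      polyR D t (fun i => Function.update y i₀ (y i₀ + μ) (Fin.cast h i)) η =
        X false y - X true y := by
      simp only [hX, ← Finset.sum_sub_distrib, polyR_cast]
      exact Finset.sum_congr rfl fun η _ => by simp; ring
    rw [h1, Fintype.sum_bool]
    nlinarith [sq_nonneg (X false y + X true y)]
  refine (lintegral_mono fun y => ENNReal.ofReal_le_ofReal (hle y)).trans ?_
  refine (lintegral_ofReal_const_mul_sum_le Finset.univ hXm zero_le_two
    (b := fun _ => B) (fun _ => hB) ?_).trans_eq ?_
  · rintro (_ | _) _
    · simpa [hX] using hD.lintegral_sum_polyQ_sq_le hK hμ (secondHalf h) i₀ v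
    · simpa [hX] using hD.lintegral_sum_polyQ_sq_le hK hμ (firstHalf h) i₀ v
  · simp; ring_nf

theorem IsPoincare.integrable_polyR [IsProbabilityMeasure D] (hD : IsPoincare 1 D)
    (μ : Vec d) {t : ℕ} (h : 2 * t = m) (i₀ : Fin m) (η : Fin t → Fin d) :
    Integrable (fun y => polyR D t
        (fun i => Function.update y i₀ (y i₀ + μ) (Fin.cast h i)) η)
      (Measure.pi fun _ : Fin m => D) := by
  simp only [polyR_cast]
  exact (hD.integrable_polyQ μ _ i₀ η).neg.add (hD.integrable_polyQ μ _ i₀ η)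

theorem IsPoincare.integral_polyR [IsProbabilityMeasure D] (hD : IsPoincare 1 D)
    (μ : Vec d) {t : ℕ} (ht : 0 < t) (h : 2 * t = m) {i₀ : Fin m} (hi₀ : (i₀ : ℕ) = 0)
    (η : Fin t → Fin d) :
    ∫ y, polyR D t (fun i => Function.update y i₀ (y i₀ + μ) (Fin.cast h i)) η
        ∂(Measure.pi fun _ : Fin m => D) = tensorPow μ t η := by
  classical
  simp only [polyR_cast]
  have h1 := (hD.integrable_polyQ μ (firstHalf h) i₀ η).fun_neg
  rw [integral_add h1 (hD.integrable_polyQ μ _ i₀ η),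
    integral_neg, hD.integral_polyQ μ ht, hD.integral_polyQ μ ht, if_pos, if_neg]
  · simp [tensorPow]
  · rintro ⟨i, hi⟩
    have := congrArg Fin.val hi
    simp [secondHalf] at this
    omega
  · exact ⟨⟨0, ht⟩, Fin.ext (by simp [firstHalf, hi₀])⟩

end Estimator

/-! ### One step of the algorithm with a fixed projection -/

section Mixture

variable {d k m : ℕ} {D : Measure (Vec d)} {w : Fin k → ℝ} {μ : Fin k → Vec d}

instance isProbabilityMeasure_shift [IsProbabilityMeasure D] (u : Vec d) :
    IsProbabilityMeasure (shift D u) :=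
  Measure.isProbabilityMeasure_map (by fun_prop)

theorem isProbabilityMeasure_mixture [IsProbabilityMeasure D] (hw : ∀ i, 0 ≤ w i)
    (hw1 : ∑ i, w i = 1) : IsProbabilityMeasure (mixture D w μ) := by
  constructor
  rw [mixture, Measure.finsetSum_apply]
  simp only [Measure.smul_apply, measure_univ, smul_eq_mul, mul_one]
  rw [← ENNReal.ofReal_sum_of_nonneg fun i _ => hw i, hw1, ENNReal.ofReal_one]

theorem measurable_cons_vec : Measurable fun q : Vec d × (Fin m → Vec d) =>
    (Fin.cons q.1 q.2 : Fin (m + 1) → Vec d) := by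
  refine measurable_pi_lambda _ fun i => ?_
  refine Fin.cases ?_ (fun i => ?_) i <;> simp only [Fin.cons_zero, Fin.cons_succ] <;> fun_prop

theorem measurable_update_add_vec (u : Vec d) : Measurable fun y : Fin (m + 1) → Vec d =>
    Function.update y 0 (y 0 + u) := by
  refine measurable_pi_lambda _ fun i => ?_
  refine Fin.cases ?_ (fun i => ?_) i
  · simp only [Function.update_self]; fun_prop
  · simp only [ne_eq, Fin.succ_ne_zero, not_false_eq_true, Function.update_of_ne]; fun_prop

/-- Reduces samples of the mixture to i.i.d. samples of `D` with coordinate `0` shifted, the setting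
of the previous estimates. -/
theorem map_cons_mixture_prod [IsProbabilityMeasure D] [IsProbabilityMeasure (mixture D w μ)] :
    ((mixture D w μ).prod (Measure.pi fun _ : Fin m => D)).map
        (fun q => (Fin.cons q.1 q.2 : Fin (m + 1) → Vec d)) =
      ∑ i, ENNReal.ofReal (w i) • (Measure.pi fun _ : Fin (m + 1) => D).map
        (fun y => Function.update y 0 (y 0 + μ i)) := by
  have hcons := measurable_cons_vec (d := d) (m := m)
  have hupd := measurable_update_add_vec (d := d) (m := m)
  have hpi := (measurePreserving_piFinSuccAbove (fun _ : Fin (m + 1) => D) 0).symm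
  refine Measure.ext_of_lintegral _ fun f hf => ?_
  rw [lintegral_map hf hcons, lintegral_prod _ (by fun_prop), mixture,
    lintegral_finsetSum_measure, lintegral_finsetSum_measure]
  refine Finset.sum_congr rfl fun i _ => ?_
  have hinner : Measurable fun z => ∫⁻ x, f (Fin.cons z x) ∂(Measure.pi fun _ : Fin m => D) :=
    Measurable.lintegral_prod_right' (f := fun q : Vec d × (Fin m → Vec d) => f (Fin.cons q.1 q.2))
      (by fun_prop)
  rw [lintegral_smul_measure, lintegral_smul_measure, lintegral_map hf (hupd _), shift,
    lintegral_map hinner (by fun_prop), ← hpi.lintegral_comp_emb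
      (MeasurableEquiv.measurableEmbedding _), lintegral_prod _ (by
        refine Measurable.aemeasurable ?_
        exact (hf.comp (hupd _)).comp (MeasurableEquiv.measurable _))]
  congr 1
  refine lintegral_congr fun z => lintegral_congr fun x => ?_
  congr 1
  funext j
  refine Fin.cases ?_ (fun j => ?_) j
  · simp [MeasurableEquiv.piFinSuccAbove]
  · simp [MeasurableEquiv.piFinSuccAbove]

theorem norm_le_muMax (i : Fin k) : ‖μ i‖ ≤ muMax μ :=
  (le_ciSup (Set.finite_range fun i => ‖μ i‖).bddAbove i).trans (le_max_right _ _)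

theorem one_le_muMax : 1 ≤ muMax μ := le_max_left _ _

/-- The bound on the second moments of the coordinates of `R_t`. -/
def secondMomentBound (μ : Fin k → Vec d) (t : ℕ) : ℝ :=
  4 * (((t : ℝ) ^ t * 2 ^ t) ^ 2 * ((t.factorial : ℝ) ^ 2 * (muMax μ ^ 2) ^ t))

theorem secondMomentBound_nonneg (t : ℕ) : 0 ≤ secondMomentBound μ t := by
  unfold secondMomentBound; positivity

theorem measurable_polyR [IsProbabilityMeasure D] {t : ℕ} (h : 2 * t = m) (η : Fin t → Fin d) :
    Measurable fun y : Fin m → Vec d => polyR D t (fun j => y (Fin.cast h j)) η := by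
  subst h
  exact (continuous_polyR (D := D) η).measurable

theorem measurable_sum_polyR [IsProbabilityMeasure D] {t : ℕ} (h : 2 * t = m)
    (v : (Fin t → Fin d) → ℝ) : Measurable fun y : Fin m → Vec d => ∑ η, v η *
      polyR D t (fun j => y (Fin.cast h j)) η :=
  Finset.measurable_fun_sum _ fun η _ => (measurable_polyR h η).const_mul (v η)

theorem IsPoincare.lintegral_mixture_polyR_sq_le [IsProbabilityMeasure D]
    [IsProbabilityMeasure (mixture D w μ)] (hD : IsPoincare 1 D) (hw : ∀ i, 0 ≤ w i)
    (hw1 : ∑ i, w i = 1) {t : ℕ} (h : 2 * t = m + 1) (v : (Fin t → Fin d) → ℝ)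
    (hv : ∑ η, v η ^ 2 = 1) :
    ∫⁻ q, ENNReal.ofReal ((∑ η, v η *
        polyR D t (fun j => (Fin.cons q.1 q.2 : Fin (m + 1) → Vec d) (Fin.cast h j)) η) ^ 2)
        ∂((mixture D w μ).prod (Measure.pi fun _ : Fin m => D)) ≤
      ENNReal.ofReal (secondMomentBound μ t) := by
  have hg : Measurable fun y : Fin (m + 1) → Vec d => ENNReal.ofReal ((∑ η, v η *
      polyR D t (fun j => y (Fin.cast h j)) η) ^ 2) := by
    have := measurable_sum_polyR (D := D) h v
    fun_prop
  rw [← lintegral_map hg measurable_cons_vec, map_cons_mixture_prod, lintegral_finsetSum_measure]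
  have hK : 1 ≤ muMax μ ^ 2 := one_le_pow₀ one_le_muMax
  calc _ ≤ ∑ i, ENNReal.ofReal (w i) * ENNReal.ofReal (secondMomentBound μ t) := by
        refine Finset.sum_le_sum fun i _ => ?_
        rw [lintegral_smul_measure, lintegral_map hg (measurable_update_add_vec _), smul_eq_mul]
        gcongr
        have hμ : ∑ a, μ i a ^ 2 ≤ muMax μ ^ 2 := by
          rw [← EuclideanSpace.real_norm_sq_eq]
          exact pow_le_pow_left₀ (norm_nonneg _) (norm_le_muMax i) 2
        have h1 := hD.lintegral_sum_polyR_sq_le hK hμ h 0 v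
        rw [hv, mul_one] at h1
        exact h1
    _ = ENNReal.ofReal (secondMomentBound μ t) := by
        rw [← Finset.sum_mul, ← ENNReal.ofReal_sum_of_nonneg fun i _ => hw i, hw1,
          ENNReal.ofReal_one, one_mul]

theorem IsPoincare.integral_mixture_polyR [IsProbabilityMeasure D]
    [IsProbabilityMeasure (mixture D w μ)] (hD : IsPoincare 1 D) (hw : ∀ i, 0 ≤ w i)
    {t : ℕ} (ht : 0 < t) (h : 2 * t = m + 1) (v : (Fin t → Fin d) → ℝ) :
    ∫ q, ∑ η, v η *
        polyR D t (fun j => (Fin.cons q.1 q.2 : Fin (m + 1) → Vec d) (Fin.cast h j)) η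
        ∂((mixture D w μ).prod (Measure.pi fun _ : Fin m => D)) =
      ∑ i, w i * ∑ η, v η * tensorPow (μ i) t η := by
  have hg := measurable_sum_polyR (D := D) h v
  have hint : ∀ i, Integrable (fun y => ∑ η, v η *
      polyR D t (fun j => Function.update y 0 (y 0 + μ i) (Fin.cast h j)) η)
      (Measure.pi fun _ : Fin (m + 1) => D) := fun i =>
    integrable_finsetSum _ fun η _ => (hD.integrable_polyR (μ i) h 0 η).const_mul _
  rw [← integral_map (f := fun y : Fin (m + 1) → Vec d => ∑ η, v η *
      polyR D t (fun j => y (Fin.cast h j)) η) measurable_cons_vec.aemeasurable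
      hg.aestronglyMeasurable, map_cons_mixture_prod, integral_finsetSum_measure]
  · refine Finset.sum_congr rfl fun i _ => ?_
    rw [integral_smul_measure, integral_map (measurable_update_add_vec _).aemeasurable
      hg.aestronglyMeasurable, integral_finsetSum _ fun η _ =>
        (hD.integrable_polyR (μ i) h 0 η).const_mul _, ENNReal.toReal_ofReal (hw i), smul_eq_mul]
    simp only [integral_const_mul, hD.integral_polyR (μ i) ht h (i₀ := 0) rfl]
  · intro i _
    exact ((integrable_map_measure hg.aestronglyMeasurable
      (measurable_update_add_vec _).aemeasurable).2 (hint i)).smul_measure ENNReal.ofReal_ne_top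

end Mixture

/-! ### Averages of independent copies -/

theorem memLp_two_of_lintegral_sq_lt_top {Ω : Type*} [MeasurableSpace Ω] {P : Measure Ω}
    {f : Ω → ℝ} (hf : Measurable f) (h : ∫⁻ ω, ENNReal.ofReal (f ω ^ 2) ∂P < ∞) :
    MemLp f 2 P := by
  refine (memLp_two_iff_integrable_sq hf.aestronglyMeasurable).2 ⟨by fun_prop, ?_⟩
  rwa [hasFiniteIntegral_iff_ofReal (Filter.Eventually.of_forall fun ω => sq_nonneg _)]

/-- The mean square error of an average of independent copies. -/
theorem lintegral_average_sub_sq_le {Ω : Type*} [MeasurableSpace Ω] {P : Measure Ω}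
    [IsProbabilityMeasure P] {f : Ω → ℝ} (hf : Measurable f) {B : ℝ} (hB : 0 ≤ B)
    (h : ∫⁻ ω, ENNReal.ofReal (f ω ^ 2) ∂P ≤ ENNReal.ofReal B) {m : ℕ} (hm : 0 < m) :
    ∫⁻ ω, ENNReal.ofReal (((m : ℝ)⁻¹ * ∑ i, f (ω i) - ∫ x, f x ∂P) ^ 2)
        ∂(Measure.pi fun _ : Fin m => P) ≤ ENNReal.ofReal (B / m) := by
  have hL : MemLp f 2 P := memLp_two_of_lintegral_sq_lt_top hf (h.trans_lt ENNReal.ofReal_lt_top)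
  have hL' : ∀ i, MemLp (fun ω : Fin m → Ω => f (ω i)) 2 (Measure.pi fun _ : Fin m => P) :=
    fun i => hL.comp_measurePreserving (measurePreserving_eval _ i)
  have hm0 : (m : ℝ) ≠ 0 := by positivity
  set g : (Fin m → Ω) → ℝ := fun ω => (m : ℝ)⁻¹ * ∑ i, f (ω i) with hg
  have hgL : MemLp g 2 (Measure.pi fun _ : Fin m => P) :=
    (memLp_finsetSum _ fun i _ => hL' i).const_mul _
  have hmean : ∫ ω, g ω ∂(Measure.pi fun _ : Fin m => P) = ∫ x, f x ∂P := by
    simp only [hg]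
    rw [integral_const_mul, integral_finsetSum _ fun i _ => (hL' i).integrable one_le_two]
    have : ∀ i, ∫ ω : Fin m → Ω, f (ω i) ∂(Measure.pi fun _ : Fin m => P) = ∫ x, f x ∂P :=
      fun i => integral_comp_eval (μ := fun _ : Fin m => P) hL.aestronglyMeasurable
    simp [this, hm0]
  rw [← hmean, ← evariance_eq_lintegral_ofReal, ← ofReal_variance hgL]
  apply ENNReal.ofReal_le_ofReal
  have hvar : Var[f; P] ≤ B := by
    refine (variance_le_expectation_sq hL.aestronglyMeasurable).trans ?_
    rw [← ENNReal.ofReal_le_ofReal_iff hB]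
    change ENNReal.ofReal (∫ x, f x ^ 2 ∂P) ≤ _
    rwa [ofReal_integral_eq_lintegral_ofReal hL.integrable_sq
      (Filter.Eventually.of_forall fun ω => sq_nonneg _)]
  have hsum : Var[g; Measure.pi fun _ : Fin m => P] = ((m : ℝ)⁻¹) ^ 2 * (m * Var[f; P]) := by
    have h1 := variance_sum_pi (μ := fun _ : Fin m => P) (X := fun _ => f) fun _ => hL
    have h2 : g = fun ω => (m : ℝ)⁻¹ * (∑ i, fun ω : Fin m → Ω => f (ω i)) ω := by
      funext ω; simp [hg]
    rw [h2, variance_const_mul, h1]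
    simp
  rw [hsum]
  calc ((m : ℝ)⁻¹) ^ 2 * (m * Var[f; P]) = Var[f; P] / m := by field_simp
    _ ≤ B / m := by gcongr

/-! ### Entries of the sample matrices -/

section Entries

variable {d c r : ℕ} {D : Measure (Vec d)}

/-- A multi-index of order `2s` as a pair of multi-indices of order `s = r + 1`, each split into its
first entry and the others. -/
def splitIndex (d r : ℕ) : (Fin d × (Fin r → Fin d)) × (Fin d × (Fin r → Fin d)) ≃
    (Fin (2 * (r + 1)) → Fin d) :=
  ((Equiv.prodCongr (Fin.consEquiv fun _ => Fin d) (Fin.consEquiv fun _ => Fin d)).trans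
    (Fin.appendEquiv (r + 1) (r + 1))).trans
    (Equiv.arrowCongr (finCongr (by omega)) (Equiv.refl _))

/-- `(I_d ⊗ Γ) flat(u^{⊗ (r+1)})`. -/
def liftPow (Γ : Matrix (Fin c) (Fin r → Fin d) ℝ) (u : Vec d) (a : Fin d × Fin c) : ℝ :=
  u a.1 * Γ.mulVec (tensorPow u r) a.2

theorem tensorPow_splitIndex (u : Vec d) (q : (Fin d × (Fin r → Fin d)) × (Fin d × (Fin r → Fin d))) :
    tensorPow u (2 * (r + 1)) (splitIndex d r q) =
      (u q.1.1 * tensorPow u r q.1.2) * (u q.2.1 * tensorPow u r q.2.2) := by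
  have h : (r + 1) + (r + 1) = 2 * (r + 1) := by omega
  have h1 : ∀ i, splitIndex d r q (finCongr h i) =
      Fin.append (Fin.cons q.1.1 q.1.2 : Fin (r + 1) → Fin d) (Fin.cons q.2.1 q.2.2) i :=
    fun i => rfl
  simp only [tensorPow]
  rw [← (finCongr h).prod_comp, Fin.prod_univ_add]
  simp only [h1, Fin.append_left, Fin.append_right, Fin.prod_univ_succ, Fin.cons_zero,
    Fin.cons_succ]

theorem kronecker_one_mulVec_tensorPow (Γ : Matrix (Fin c) (Fin r → Fin d) ℝ) (u : Vec d)
    (a : Fin d × Fin c) :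
    ∑ q, ((1 : Matrix (Fin d) (Fin d) ℝ) ⊗ₖ Γ) a q * (u q.1 * tensorPow u r q.2) =
      liftPow Γ u a := by
  rw [Fintype.sum_prod_type, Finset.sum_eq_single a.1]
  · simp only [liftPow, Matrix.kroneckerMap_apply, Matrix.one_apply_eq, one_mul, Matrix.mulVec,
      dotProduct, Finset.mul_sum]
    exact Finset.sum_congr rfl fun η _ => by ring
  · intro i _ hi
    simp [Matrix.kroneckerMap_apply, Matrix.one_apply_ne hi.symm]
  · simp

theorem sum_kronecker_one_sq {Γ : Matrix (Fin c) (Fin r → Fin d) ℝ} (hΓ : Γ * Γ.transpose = 1)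
    (a : Fin d × Fin c) :
    ∑ q, ((1 : Matrix (Fin d) (Fin d) ℝ) ⊗ₖ Γ) a q ^ 2 = 1 := by
  have h := congrFun (congrFun hΓ a.2) a.2
  rw [Matrix.one_apply_eq, Matrix.mul_apply] at h
  rw [← h, Fintype.sum_prod_type, Finset.sum_eq_single a.1]
  · simp [sq]
  · intro i _ hi
    simp [Matrix.one_apply_ne hi.symm]
  · simp

/-- The coefficients of the entry `(a, b)` of the sample matrix. -/
def entryCoeff (Γ : Matrix (Fin c) (Fin r → Fin d) ℝ) (a b : Fin d × Fin c)
    (η : Fin (2 * (r + 1)) → Fin d) : ℝ :=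
  ((1 : Matrix (Fin d) (Fin d) ℝ) ⊗ₖ Γ) a ((splitIndex d r).symm η).1 *
    ((1 : Matrix (Fin d) (Fin d) ℝ) ⊗ₖ Γ) b ((splitIndex d r).symm η).2

theorem sampleMatrix_apply (Γ : Matrix (Fin c) (Fin r → Fin d) ℝ) (z : Vec d)
    (x : Fin (4 * (r + 1) - 1) → Vec d) (a b : Fin d × Fin c) :
    sampleMatrix D Γ z x a b = ∑ η, entryCoeff Γ a b η *
      polyR D (2 * (r + 1)) (fun j => (Fin.cons z x : Fin (4 * (r + 1) - 1 + 1) → Vec d)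
        (Fin.cast (by omega) j)) η := by
  rw [← Equiv.sum_comp (splitIndex d r)]
  simp only [entryCoeff, Equiv.symm_apply_apply]
  rfl

/-- A tensor product of two unit rows is a unit vector, so the second moment bound for an entry does
not grow with `d ^ (2s)`. -/
theorem sum_entryCoeff_sq {Γ : Matrix (Fin c) (Fin r → Fin d) ℝ} (hΓ : Γ * Γ.transpose = 1)
    (a b : Fin d × Fin c) : ∑ η, entryCoeff Γ a b η ^ 2 = 1 := by
  rw [← Equiv.sum_comp (splitIndex d r)]
  simp only [entryCoeff, Equiv.symm_apply_apply, mul_pow]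
  have h := Fintype.sum_mul_sum (fun q => ((1 : Matrix (Fin d) (Fin d) ℝ) ⊗ₖ Γ) a q ^ 2)
    (fun q => ((1 : Matrix (Fin d) (Fin d) ℝ) ⊗ₖ Γ) b q ^ 2)
  rw [sum_kronecker_one_sq hΓ, sum_kronecker_one_sq hΓ, one_mul] at h
  rw [Fintype.sum_prod_type]
  exact h.symm

theorem sum_entryCoeff_mul_tensorPow (Γ : Matrix (Fin c) (Fin r → Fin d) ℝ)
    (a b : Fin d × Fin c) (u : Vec d) :
    ∑ η, entryCoeff Γ a b η * tensorPow u (2 * (r + 1)) η = liftPow Γ u a * liftPow Γ u b := by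
  rw [← Equiv.sum_comp (splitIndex d r)]
  simp only [entryCoeff, Equiv.symm_apply_apply, tensorPow_splitIndex]
  rw [← kronecker_one_mulVec_tensorPow, ← kronecker_one_mulVec_tensorPow,
    Fintype.sum_mul_sum, Fintype.sum_prod_type]
  exact Finset.sum_congr rfl fun q _ => Finset.sum_congr rfl fun q' _ => by ring

/-- The expectation `(I ⊗ Γ) M_{2s} (I ⊗ Γ)ᵀ` of the sample matrices. -/
def meanMatrix {k : ℕ} (w : Fin k → ℝ) (μ : Fin k → Vec d)
    (Γ : Matrix (Fin c) (Fin r → Fin d) ℝ) : Matrix (Fin d × Fin c) (Fin d × Fin c) ℝ :=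
  Matrix.of fun a b => ∑ i, w i * (liftPow Γ (μ i) a * liftPow Γ (μ i) b)

theorem measurable_sampleMatrix_apply [IsProbabilityMeasure D]
    (Γ : Matrix (Fin c) (Fin r → Fin d) ℝ) (a b : Fin d × Fin c) :
    Measurable fun q : Vec d × (Fin (4 * (r + 1) - 1) → Vec d) =>
      sampleMatrix D Γ q.1 q.2 a b := by
  simp only [sampleMatrix_apply]
  exact (measurable_sum_polyR (D := D) (by omega) (entryCoeff Γ a b)).comp measurable_cons_vec

variable {k : ℕ} {w : Fin k → ℝ} {μ : Fin k → Vec d}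

/-- `Γ` is deterministic here; the data dependence of `Γ` is dealt with in `lintegral_runError_le`.
-/
theorem IsPoincare.lintegral_estimateMoment_sub_sq_le [IsProbabilityMeasure D]
    [IsProbabilityMeasure (mixture D w μ)] (hD : IsPoincare 1 D) (hw : ∀ i, 0 ≤ w i)
    (hw1 : ∑ i, w i = 1) {Γ : Matrix (Fin c) (Fin r → Fin d) ℝ} (hΓ : Γ * Γ.transpose = 1)
    {m : ℕ} (hm : 0 < m) (a b : Fin d × Fin c) :
    ∫⁻ z, ∫⁻ x, ENNReal.ofReal ((estimateMoment D Γ z x a b - meanMatrix w μ Γ a b) ^ 2)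
        ∂(Measure.pi fun _ : Fin m => Measure.pi fun _ : Fin (4 * (r + 1) - 1) => D)
        ∂(Measure.pi fun _ : Fin m => mixture D w μ) ≤
      ENNReal.ofReal (secondMomentBound μ (2 * (r + 1)) / m) := by
  set P := (mixture D w μ).prod (Measure.pi fun _ : Fin (4 * (r + 1) - 1) => D) with hP
  set f : Vec d × (Fin (4 * (r + 1) - 1) → Vec d) → ℝ := fun q =>
    sampleMatrix D Γ q.1 q.2 a b with hf
  have hfm : Measurable f := measurable_sampleMatrix_apply Γ a b
  have h2 : 2 * (2 * (r + 1)) = 4 * (r + 1) - 1 + 1 := by omega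
  have hsq : ∫⁻ q, ENNReal.ofReal (f q ^ 2) ∂P ≤
      ENNReal.ofReal (secondMomentBound μ (2 * (r + 1))) := by
    simp only [hf, sampleMatrix_apply]
    exact hD.lintegral_mixture_polyR_sq_le hw hw1 h2 _ (sum_entryCoeff_sq hΓ a b)
  have hmean : ∫ q, f q ∂P = meanMatrix w μ Γ a b := by
    simp only [hf, sampleMatrix_apply]
    refine (hD.integral_mixture_polyR hw (by omega) h2 _).trans ?_
    simp only [sum_entryCoeff_mul_tensorPow, meanMatrix, Matrix.of_apply]
  have h := lintegral_average_sub_sq_le hfm (secondMomentBound_nonneg _) hsq hm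
  rw [hmean] at h
  have hmp := measurePreserving_arrowProdEquivProdArrow (Vec d)
    (Fin (4 * (r + 1) - 1) → Vec d) (Fin m) (fun _ => mixture D w μ)
    (fun _ => Measure.pi fun _ : Fin (4 * (r + 1) - 1) => D)
  have hest : ∀ z x, estimateMoment D Γ z x a b = (m : ℝ)⁻¹ * ∑ i : Fin m, f (z i, x i) := by
    intro z x
    simp [estimateMoment, hf, Matrix.sum_apply]
  simp only [hest]
  rw [← lintegral_prod (f := fun q : (Fin m → Vec d) × (Fin m → Fin (4 * (r + 1) - 1) → Vec d) =>
    ENNReal.ofReal (((m : ℝ)⁻¹ * ∑ i, f (q.1 i, q.2 i) - meanMatrix w μ Γ a b) ^ 2))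
    (Measurable.aemeasurable (by fun_prop)),
    ← hmp.lintegral_comp_emb (MeasurableEquiv.measurableEmbedding _)]
  exact h

end Entries

/-! ### Top singular subspaces of a perturbed low rank matrix -/

section SingularSubspace

variable {ι κ : Type} [Fintype ι] [Fintype κ]

theorem dotProduct_sq_le (x y : ι → ℝ) : (x ⬝ᵥ y) ^ 2 ≤ (x ⬝ᵥ x) * (y ⬝ᵥ y) := by
  simpa [dotProduct, sq] using Finset.sum_mul_sq_le_sq_mul_sq Finset.univ x y

/-- The Frobenius norm dominates the operator norm. -/
theorem mulVec_dotProduct_self_le (A : Matrix ι κ ℝ) (x : κ → ℝ) :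
    A.mulVec x ⬝ᵥ A.mulVec x ≤ (∑ a, ∑ b, A a b ^ 2) * (x ⬝ᵥ x) := by
  rw [dotProduct, Finset.sum_mul]
  refine Finset.sum_le_sum fun a _ => ?_
  rw [← sq]
  have h := dotProduct_sq_le (A a) x
  simpa [dotProduct, sq, Matrix.mulVec] using h

theorem dotProduct_le_of_sq_le {x y : ι → ℝ} {δ : ℝ} (hδ : 0 ≤ δ)
    (h : y ⬝ᵥ y ≤ δ ^ 2 * (x ⬝ᵥ x)) : |x ⬝ᵥ y| ≤ δ * (x ⬝ᵥ x) := by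
  have hx : 0 ≤ x ⬝ᵥ x := Finset.sum_nonneg fun i _ => mul_self_nonneg _
  refine abs_le_of_sq_le_sq ?_ (mul_nonneg hδ hx)
  calc (x ⬝ᵥ y) ^ 2 ≤ (x ⬝ᵥ x) * (y ⬝ᵥ y) := dotProduct_sq_le x y
    _ ≤ (x ⬝ᵥ x) * (δ ^ 2 * (x ⬝ᵥ x)) := by gcongr
    _ = (δ * (x ⬝ᵥ x)) ^ 2 := by ring

theorem inner_toLp_eq_dotProduct (x : ι → ℝ) (y : EuclideanSpace ℝ ι) :
    inner ℝ y (WithLp.toLp 2 x) = x ⬝ᵥ y.ofLp := by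
  simp [PiLp.inner_apply, dotProduct]

/-- The matrix `∑ i, w i • u i (u i)ᵀ`. -/
def weightedGram {k : ℕ} (w : Fin k → ℝ) (u : Fin k → ι → ℝ) : Matrix ι ι ℝ :=
  Matrix.of fun a b => ∑ i, w i * (u i a * u i b)

theorem weightedGram_mulVec {k : ℕ} (w : Fin k → ℝ) (u : Fin k → ι → ℝ) (x : ι → ℝ) (a : ι) :
    (weightedGram w u).mulVec x a = ∑ i, w i * (u i ⬝ᵥ x) * u i a := by
  simp only [weightedGram, Matrix.mulVec, dotProduct, Matrix.of_apply, Finset.sum_mul,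
    Finset.mul_sum]
  rw [Finset.sum_comm]
  exact Finset.sum_congr rfl fun i _ => Finset.sum_congr rfl fun b _ => by ring

theorem dotProduct_weightedGram_mulVec {k : ℕ} (w : Fin k → ℝ) (u : Fin k → ι → ℝ) (x : ι → ℝ) :
    x ⬝ᵥ (weightedGram w u).mulVec x = ∑ i, w i * (u i ⬝ᵥ x) ^ 2 := by
  have h : x ⬝ᵥ (weightedGram w u).mulVec x = ∑ a, ∑ i, w i * (u i ⬝ᵥ x) * (u i a * x a) := by
    refine Finset.sum_congr rfl fun a _ => ?_
    rw [weightedGram_mulVec, Finset.mul_sum]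
    exact Finset.sum_congr rfl fun i _ => by ring
  rw [h, Finset.sum_comm]
  refine Finset.sum_congr rfl fun i _ => ?_
  rw [← Finset.mul_sum]
  change w i * (u i ⬝ᵥ x) * (u i ⬝ᵥ x) = _
  ring

theorem mulVec_dotProduct_eq_sum {A : Matrix ι ι ℝ}
    {v : OrthonormalBasis (Fin (Fintype.card ι)) ℝ (EuclideanSpace ℝ ι)}
    {σ : Fin (Fintype.card ι) → ℝ}
    (h : ∀ j, (A.transpose * A).mulVec (v j).ofLp = σ j ^ 2 • (v j).ofLp) (x : ι → ℝ) :
    A.mulVec x ⬝ᵥ A.mulVec x = ∑ j, σ j ^ 2 * (x ⬝ᵥ (v j).ofLp) ^ 2 := by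
  have hx : x = ∑ j, (x ⬝ᵥ (v j).ofLp) • (v j).ofLp := by
    have := congrArg WithLp.ofLp (v.sum_repr' (WithLp.toLp 2 x))
    simp only [inner_toLp_eq_dotProduct, WithLp.ofLp_sum, WithLp.ofLp_smul] at this
    exact this.symm
  have h1 : A.mulVec x ⬝ᵥ A.mulVec x = x ⬝ᵥ (A.transpose * A).mulVec x := by
    rw [← Matrix.mulVec_mulVec, Matrix.dotProduct_mulVec x, Matrix.vecMul_transpose]
  rw [h1]
  conv_lhs => rw [hx, Matrix.mulVec_sum]
  rw [← hx, dotProduct_sum]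
  refine Finset.sum_congr rfl fun j _ => ?_
  rw [Matrix.mulVec_smul, h, dotProduct_smul, dotProduct_smul, smul_eq_mul, smul_eq_mul]
  ring

theorem dotProduct_self_eq_sum
    (v : OrthonormalBasis (Fin (Fintype.card ι)) ℝ (EuclideanSpace ℝ ι)) (x : ι → ℝ) :
    x ⬝ᵥ x = ∑ j, (x ⬝ᵥ (v j).ofLp) ^ 2 := by
  have h := v.sum_sq_norm_inner_right (WithLp.toLp 2 x)
  simp only [inner_toLp_eq_dotProduct, Real.norm_eq_abs, sq_abs] at h
  rw [h, EuclideanSpace.real_norm_sq_eq]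
  simp [dotProduct, sq]

/-- Weyl-type bound. Among the first `k + 1` singular vectors some nonzero combination `y` is
orthogonal to all `k` vectors `u i`. There `A` agrees with the perturbation, yet stretches `y` by at
least the singular value with index `k`. -/
theorem singularValue_le {k : ℕ} {A : Matrix ι ι ℝ} {w : Fin k → ℝ} {u : Fin k → ι → ℝ} {δ : ℝ}
    (hA : ∑ a, ∑ b, (A a b - weightedGram w u a b) ^ 2 ≤ δ ^ 2)
    {v : OrthonormalBasis (Fin (Fintype.card ι)) ℝ (EuclideanSpace ℝ ι)}
    {σ : Fin (Fintype.card ι) → ℝ} (hσ : Antitone σ) (hσ0 : ∀ j, 0 ≤ σ j)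
    (h : ∀ j, (A.transpose * A).mulVec (v j).ofLp = σ j ^ 2 • (v j).ofLp)
    (hk : k < Fintype.card ι) : σ ⟨k, hk⟩ ^ 2 ≤ δ ^ 2 := by
  set e : Fin (k + 1) ↪ Fin (Fintype.card ι) := Fin.castLEEmb hk with he
  set L : Matrix (Fin k) (Fin (k + 1)) ℝ := Matrix.of fun i j => u i ⬝ᵥ (v (e j)).ofLp with hL
  have hker : LinearMap.ker L.mulVecLin ≠ ⊥ := LinearMap.ker_ne_bot_of_finrank_lt (by simp)
  obtain ⟨a, ha, ha0⟩ := Submodule.exists_mem_ne_zero_of_ne_bot hker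
  rw [LinearMap.mem_ker, Matrix.mulVecLin_apply] at ha
  set y : ι → ℝ := ∑ j, a j • (v (e j)).ofLp with hy
  have huy : ∀ i, u i ⬝ᵥ y = 0 := by
    intro i
    simp only [hy, dotProduct_sum, dotProduct_smul]
    refine Eq.trans ?_ (congrFun ha i)
    simp only [Matrix.mulVec, hL, dotProduct, Matrix.of_apply]
    exact Finset.sum_congr rfl fun j _ => by rw [smul_eq_mul]; ring
  have hvv : ∀ i j, (v i).ofLp ⬝ᵥ (v j).ofLp = if i = j then 1 else 0 := by
    intro i j
    have := orthonormal_iff_ite.1 v.orthonormal j i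
    rw [← inner_toLp_eq_dotProduct]
    simpa [eq_comm] using this
  have hcoef : ∀ j, y ⬝ᵥ (v (e j)).ofLp = a j := by
    intro j
    simp only [hy, sum_dotProduct, smul_dotProduct, hvv, smul_eq_mul]
    simp
  have hcoef0 : ∀ j, j ∉ Finset.univ.map e → y ⬝ᵥ (v j).ofLp = 0 := by
    intro j hj
    simp only [hy, sum_dotProduct, smul_dotProduct, hvv, smul_eq_mul]
    refine Finset.sum_eq_zero fun i _ => ?_
    rw [if_neg, mul_zero]
    rintro rfl
    exact hj (by simp)
  have hsum : ∀ f : Fin (Fintype.card ι) → ℝ, ∑ j, f j * (y ⬝ᵥ (v j).ofLp) ^ 2 =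
      ∑ j, f (e j) * a j ^ 2 := by
    intro f
    rw [← Finset.sum_subset (Finset.subset_univ (Finset.univ.map e)), Finset.sum_map]
    · simp only [hcoef]
    · intro j _ hj
      rw [hcoef0 j hj]; ring
  have hBy : (weightedGram w u).mulVec y = 0 := by
    funext b
    rw [weightedGram_mulVec]
    simp [huy]
  have hAy : A.mulVec y = (A - weightedGram w u).mulVec y := by
    rw [Matrix.sub_mulVec, hBy, sub_zero]
  have hyy : y ⬝ᵥ y = ∑ j, a j ^ 2 := by
    have := hsum fun _ => 1
    simp only [one_mul] at this
    rw [dotProduct_self_eq_sum v, this]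
  have hpos : 0 < ∑ j, a j ^ 2 := by
    obtain ⟨j, hj⟩ := Function.ne_iff.1 ha0
    exact Finset.sum_pos' (fun i _ => sq_nonneg _) ⟨j, Finset.mem_univ _, sq_pos_iff.2 hj⟩
  have h1 : σ ⟨k, hk⟩ ^ 2 * ∑ j, a j ^ 2 ≤ δ ^ 2 * ∑ j, a j ^ 2 := by
    calc σ ⟨k, hk⟩ ^ 2 * ∑ j, a j ^ 2 ≤ ∑ j, σ (e j) ^ 2 * a j ^ 2 := by
          rw [Finset.mul_sum]
          refine Finset.sum_le_sum fun j _ => ?_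
          gcongr
          · exact hσ0 _
          · apply hσ
            exact Nat.lt_succ_iff.1 j.2
      _ = A.mulVec y ⬝ᵥ A.mulVec y := by rw [mulVec_dotProduct_eq_sum h, hsum]
      _ ≤ δ ^ 2 * ∑ j, a j ^ 2 := by
          rw [hAy, ← hyy]
          refine (mulVec_dotProduct_self_le _ _).trans ?_
          refine mul_le_mul_of_nonneg_right hA ?_
          rw [hyy]; exact hpos.le
  exact le_of_mul_le_mul_right h1 hpos

variable [DecidableEq ι]

theorem IsTopSingularBasis.mulVec_dotProduct_le {k r : ℕ} {A : Matrix ι ι ℝ}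
    {P : Matrix (Fin r) ι ℝ} (hP : IsTopSingularBasis A P) (hr : r = min k (Fintype.card ι))
    {w : Fin k → ℝ} {u : Fin k → ι → ℝ} {δ : ℝ}
    (hA : ∑ a, ∑ b, (A a b - weightedGram w u a b) ^ 2 ≤ δ ^ 2) {x : ι → ℝ}
    (hx : P.mulVec x = 0) : A.mulVec x ⬝ᵥ A.mulVec x ≤ δ ^ 2 * (x ⬝ᵥ x) := by
  obtain ⟨_, v, σ, hσ, hσ0, hv, hspan⟩ := hP
  have horth : ∀ j : Fin (Fintype.card ι), (j : ℕ) < r → x ⬝ᵥ (v j).ofLp = 0 := by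
    intro j hj
    have hmem : v j ∈ Submodule.span ℝ (Set.range fun a =>
        (WithLp.toLp 2 (P.row a) : EuclideanSpace ℝ ι)) := by
      rw [hspan]
      exact Submodule.subset_span ⟨j, hj, rfl⟩
    have hall : ∀ z ∈ Submodule.span ℝ (Set.range fun a =>
        (WithLp.toLp 2 (P.row a) : EuclideanSpace ℝ ι)), x ⬝ᵥ z.ofLp = 0 := by
      intro z hz
      induction hz using Submodule.span_induction with
      | mem z hz =>
        obtain ⟨a, rfl⟩ := hz
        rw [dotProduct_comm]
        exact congrFun hx a
      | zero => simp
      | add y z _ _ hy hz => rw [WithLp.ofLp_add, dotProduct_add, hy, hz, add_zero]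
      | smul c z _ hz => rw [WithLp.ofLp_smul, dotProduct_smul, hz, smul_zero]
    exact hall _ hmem
  rw [mulVec_dotProduct_eq_sum hv, dotProduct_self_eq_sum v, Finset.mul_sum]
  refine Finset.sum_le_sum fun j _ => ?_
  by_cases hj : (j : ℕ) < r
  · simp [horth j hj]
  -- An index `j ≥ r` below the dimension exists only if the minimum defining `r` is `k`.
  · have hk : k < Fintype.card ι := by have := j.2; omega
    refine mul_le_mul_of_nonneg_right ?_ (sq_nonneg _)
    refine le_trans ?_ (singularValue_le hA hσ hσ0 hv hk)
    gcongr
    · exact hσ0 _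
    · apply hσ
      change k ≤ (j : ℕ)
      omega

/-- Let `x` be the component of `u i` orthogonal to the rows of `P`. The Gram form at `x` is at
least `w i ‖x‖⁴` because `u i ⬝ᵥ x = ‖x‖²`. It is at most `2 δ ‖x‖²`: one `δ` bounds `A` on the
kernel of `P`, the other the perturbation. No gap between singular values is needed. -/
theorem IsTopSingularBasis.le_mulVec_dotProduct {k r : ℕ} {A : Matrix ι ι ℝ}
    {P : Matrix (Fin r) ι ℝ} (hP : IsTopSingularBasis A P) (hr : r = min k (Fintype.card ι))
    {w : Fin k → ℝ} (hw : ∀ i, 0 ≤ w i) {u : Fin k → ι → ℝ} {δ : ℝ} (hδ : 0 ≤ δ)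
    (hA : ∑ a, ∑ b, (A a b - weightedGram w u a b) ^ 2 ≤ δ ^ 2) (i : Fin k) :
    w i * (u i ⬝ᵥ u i - P.mulVec (u i) ⬝ᵥ P.mulVec (u i)) ≤ 2 * δ := by
  set x : ι → ℝ := u i - P.transpose.mulVec (P.mulVec (u i)) with hx
  have hPx : P.mulVec x = 0 := by
    rw [hx, Matrix.mulVec_sub, Matrix.mulVec_mulVec, hP.1, Matrix.one_mulVec, sub_self]
  have horth : ∀ y, P.transpose.mulVec y ⬝ᵥ x = 0 := by
    intro y
    rw [Matrix.mulVec_transpose, ← Matrix.dotProduct_mulVec, hPx, dotProduct_zero]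
  have hux : u i ⬝ᵥ x = x ⬝ᵥ x := by
    conv_rhs => rw [hx, sub_dotProduct, ← hx, horth, sub_zero]
  have hxx : x ⬝ᵥ x = u i ⬝ᵥ u i - P.mulVec (u i) ⬝ᵥ P.mulVec (u i) := by
    rw [← hux, hx, dotProduct_sub, Matrix.dotProduct_mulVec, Matrix.vecMul_transpose]
  rw [← hxx]
  have hx0 : 0 ≤ x ⬝ᵥ x := Finset.sum_nonneg fun i _ => mul_self_nonneg _
  have h1 : w i * (x ⬝ᵥ x) ^ 2 ≤ x ⬝ᵥ (weightedGram w u).mulVec x := by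
    rw [dotProduct_weightedGram_mulVec, ← hux]
    exact Finset.single_le_sum (f := fun j => w j * (u j ⬝ᵥ x) ^ 2)
      (fun j _ => mul_nonneg (hw j) (sq_nonneg _)) (Finset.mem_univ i)
  have h2 := dotProduct_le_of_sq_le hδ (hP.mulVec_dotProduct_le hr hA hPx)
  have h3 : (A - weightedGram w u).mulVec x ⬝ᵥ (A - weightedGram w u).mulVec x ≤
      δ ^ 2 * (x ⬝ᵥ x) :=
    (mulVec_dotProduct_self_le _ _).trans (mul_le_mul_of_nonneg_right hA hx0)
  have h4 := dotProduct_le_of_sq_le hδ h3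
  have h5 : x ⬝ᵥ (weightedGram w u).mulVec x =
      x ⬝ᵥ A.mulVec x - x ⬝ᵥ (A - weightedGram w u).mulVec x := by
    rw [Matrix.sub_mulVec, dotProduct_sub]; ring
  have h6 : w i * (x ⬝ᵥ x) ^ 2 ≤ 2 * δ * (x ⬝ᵥ x) := by
    rw [h5] at h1
    linarith [(abs_le.1 h2).2, (abs_le.1 h4).1]
  rcases hx0.eq_or_lt with h0 | h0
  · rw [← h0, mul_zero]; positivity
  · refine le_of_mul_le_mul_right ?_ h0
    linarith

end SingularSubspace

/-! ### Nested projections with orthonormal rows -/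

section Nested

variable {d c c' s : ℕ}

theorem nestStep_mul_transpose {P : Matrix (Fin c') (Fin d × Fin c) ℝ}
    {Γ : Matrix (Fin c) (Fin s → Fin d) ℝ} (hP : P * P.transpose = 1)
    (hΓ : Γ * Γ.transpose = 1) : nestStep P Γ * (nestStep P Γ).transpose = 1 := by
  have h := Matrix.submatrix_mul_equiv (P * ((1 : Matrix (Fin d) (Fin d) ℝ) ⊗ₖ Γ))
    (P * ((1 : Matrix (Fin d) (Fin d) ℝ) ⊗ₖ Γ)).transpose (id : Fin c' → Fin c')
    (Fin.consEquiv fun _ : Fin (s + 1) => Fin d).symm (id : Fin c' → Fin c')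
  refine h.trans ?_
  rw [Matrix.submatrix_id_id, Matrix.transpose_mul, Matrix.mul_assoc,
    ← Matrix.mul_assoc _ _ P.transpose, ← Matrix.kroneckerMap_transpose, ← Matrix.mul_kronecker_mul,
    hΓ, Matrix.transpose_one, Matrix.one_mul, Matrix.one_kronecker_one, Matrix.one_mul, hP]

theorem nestStep_mulVec_tensorPow (P : Matrix (Fin c') (Fin d × Fin c) ℝ)
    (Γ : Matrix (Fin c) (Fin s → Fin d) ℝ) (u : Vec d) :
    (nestStep P Γ).mulVec (tensorPow u (s + 1)) = P.mulVec (liftPow Γ u) := by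
  have h : liftPow Γ u = ((1 : Matrix (Fin d) (Fin d) ℝ) ⊗ₖ Γ).mulVec
      (fun q => u q.1 * tensorPow u s q.2) := by
    funext a
    exact (kronecker_one_mulVec_tensorPow Γ u a).symm
  rw [h, Matrix.mulVec_mulVec]
  funext a
  simp only [nestStep, Matrix.mulVec, dotProduct]
  rw [← (Fin.consEquiv fun _ : Fin (s + 1) => Fin d).sum_comp]
  refine Finset.sum_congr rfl fun q _ => ?_
  simp [Fin.consEquiv, tensorPow, Fin.prod_univ_succ]

theorem liftPow_dotProduct_self (Γ : Matrix (Fin c) (Fin s → Fin d) ℝ) (u : Vec d) :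
    liftPow Γ u ⬝ᵥ liftPow Γ u =
      ‖u‖ ^ 2 * (Γ.mulVec (tensorPow u s) ⬝ᵥ Γ.mulVec (tensorPow u s)) := by
  rw [EuclideanSpace.real_norm_sq_eq, dotProduct, dotProduct, Fintype.sum_mul_sum,
    Fintype.sum_prod_type]
  exact Finset.sum_congr rfl fun a _ => Finset.sum_congr rfl fun b _ => by
    simp only [liftPow]; ring

end Nested

/-! ### The run of the algorithm -/

section Run

variable {d k n t : ℕ} {D : Measure (Vec d)} {svd : Routine k d}

theorem stepMatrix_zero_mul_transpose (ω : Samples d n t)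
    (Γ : Matrix (Fin (rows k d 0)) (Fin 0 → Fin d) ℝ) :
    stepMatrix D svd ω 0 Γ * (stepMatrix D svd ω 0 Γ).transpose = 1 := by
  funext a a'
  rw [Matrix.mul_apply, Fintype.sum_prod_type]
  revert a a'
  intro (a : Fin d) (a' : Fin d)
  change ∑ b : Fin d, ∑ _ : Fin 1, (if a = b then (1 : ℝ) else 0) * (if a' = b then 1 else 0) =
    (1 : Matrix (Fin d) (Fin d) ℝ) a a'
  simp [Matrix.one_apply]

theorem runProj_mul_transpose (hsvd : IsSingularRoutine svd) (ω : Samples d n t) :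
    ∀ s ≤ t, runProj D svd ω s * (runProj D svd ω s).transpose = 1 := by
  intro s
  induction s with
  | zero =>
    intro _
    funext a b
    have ha : a = b := Subsingleton.elim (α := Fin 1) a b
    subst ha
    rw [Matrix.mul_apply, Matrix.one_apply_eq]
    simp [runProj]
  | succ s ih =>
    intro hs
    refine nestStep_mul_transpose ?_ (ih (by omega))
    cases s with
    | zero => exact stepMatrix_zero_mul_transpose ω _
    | succ s =>
      rw [stepMatrix, dif_pos (by omega)]
      exact ((hsvd (s + 1)).1 _).1

/-- The projection before a step sees only earlier batches; this is the source of independence. -/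
theorem runProj_congr {ω ω' : Samples d n t} (s : ℕ)
    (h1 : ∀ r : Fin t, (r : ℕ) < s → batch ω.1 r = batch ω'.1 r)
    (h2 : ∀ r : Fin t, (r : ℕ) < s → ω.2 r = ω'.2 r) :
    runProj D svd ω s = runProj D svd ω' s := by
  induction s with
  | zero => rfl
  | succ s ih =>
    have ih' := ih (fun r hr => h1 r (by omega)) (fun r hr => h2 r (by omega))
    simp only [runProj]
    rw [ih']
    congr 1
    cases s with
    | zero => rfl
    | succ s =>
      simp only [stepMatrix]
      split_ifs with h
      · rw [h1 ⟨s + 1, h⟩ (by simp), h2 ⟨s + 1, h⟩ (by simp)]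
      · rfl

theorem measurable_estimateMoment_apply [IsProbabilityMeasure D] {Ω : Type*} [MeasurableSpace Ω]
    {c r m : ℕ} {Γ : Ω → Matrix (Fin c) (Fin r → Fin d) ℝ}
    (hΓ : ∀ a η, Measurable fun ω => Γ ω a η) {z : Ω → Fin m → Vec d} (hz : Measurable z)
    {x : Ω → Fin m → Fin (4 * (r + 1) - 1) → Vec d} (hx : Measurable x) (a b : Fin d × Fin c) :
    Measurable fun ω => estimateMoment D (Γ ω) (z ω) (x ω) a b := by
  have hcoef : ∀ η, Measurable fun ω => entryCoeff (Γ ω) a b η := by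
    intro η
    simp only [entryCoeff, Matrix.kroneckerMap_apply]
    have := fun a η => hΓ a η
    fun_prop
  simp only [estimateMoment, Matrix.smul_apply, Matrix.sum_apply, sampleMatrix_apply, smul_eq_mul]
  refine Measurable.const_mul (Finset.measurable_fun_sum _ fun i _ =>
    Finset.measurable_fun_sum _ fun η _ => (hcoef η).mul ?_) _
  have h1 : Measurable fun ω => (Fin.cons (z ω i) (x ω i) : Fin (4 * (r + 1) - 1 + 1) → Vec d) :=
    measurable_cons_vec.comp (f := fun ω => (z ω i, x ω i)) (by fun_prop)
  exact (measurable_polyR (D := D) (by omega) η).comp h1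

theorem measurable_batch (r : Fin t) : Measurable fun z : Fin n → Vec d => batch z r := by
  unfold batch; fun_prop

/-- Here the Borel condition on the routine enters; it is what permits Fubini later. -/
theorem measurable_runProj_apply [IsProbabilityMeasure D] (hsvd : IsSingularRoutine svd) (s : ℕ) :
    ∀ a η, Measurable fun ω : Samples d n t => runProj D svd ω s a η := by
  induction s with
  | zero => intro a η; exact measurable_const
  | succ s ih =>
    intro a η
    have hstep : ∀ a b, Measurable fun ω : Samples d n t =>
        stepMatrix D svd ω s (runProj D svd ω s) a b := by
      intro a b
      cases s with
      | zero => exact measurable_const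
      | succ s =>
        simp only [stepMatrix]
        split_ifs with h
        · refine ((hsvd (s + 1)).2 a b).comp (g := fun A => svd (s + 1) (Matrix.of A) a b)
            (f := fun ω : Samples d n t => (estimateMoment D (runProj D svd ω (s + 1))
              (batch ω.1 ⟨s + 1, h⟩) (ω.2 ⟨s + 1, h⟩) :
                Fin d × Fin (rows k d (s + 1)) → Fin d × Fin (rows k d (s + 1)) → ℝ)) ?_
          refine measurable_pi_lambda _ fun i => measurable_pi_lambda _ fun j => ?_
          exact measurable_estimateMoment_apply ih ((measurable_batch _).comp measurable_fst)
            ((measurable_pi_apply _).comp measurable_snd) i j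
        · exact measurable_const
    simp only [runProj, nestStep, Matrix.submatrix_apply, Matrix.mul_apply,
      Matrix.kroneckerMap_apply]
    fun_prop

theorem measurable_liftPow {Ω : Type*} [MeasurableSpace Ω]
    {c r : ℕ} {Γ : Ω → Matrix (Fin c) (Fin r → Fin d) ℝ}
    (hΓ : ∀ a η, Measurable fun ω => Γ ω a η) (u : Vec d) (a : Fin d × Fin c) :
    Measurable fun ω => liftPow (Γ ω) u a := by
  simp only [liftPow, Matrix.mulVec, dotProduct]
  fun_prop

variable {w : Fin k → ℝ} {μ : Fin k → Vec d}

/-- The squared Frobenius error of an estimated matrix. -/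
def sqError {c r m : ℕ} (D : Measure (Vec d)) (w : Fin k → ℝ) (μ : Fin k → Vec d)
    (Γ : Matrix (Fin c) (Fin r → Fin d) ℝ) (z : Fin m → Vec d)
    (x : Fin m → Fin (4 * (r + 1) - 1) → Vec d) : ℝ :=
  ∑ a, ∑ b, (estimateMoment D Γ z x a b - meanMatrix w μ Γ a b) ^ 2

theorem measurable_sqError [IsProbabilityMeasure D] {Ω : Type*} [MeasurableSpace Ω]
    {c r m : ℕ} {Γ : Ω → Matrix (Fin c) (Fin r → Fin d) ℝ}
    (hΓ : ∀ a η, Measurable fun ω => Γ ω a η) {z : Ω → Fin m → Vec d} (hz : Measurable z)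
    {x : Ω → Fin m → Fin (4 * (r + 1) - 1) → Vec d} (hx : Measurable x) :
    Measurable fun ω => sqError D w μ (Γ ω) (z ω) (x ω) := by
  have h1 := fun a b => measurable_estimateMoment_apply (D := D) hΓ hz hx a b
  have h2 := fun u a => measurable_liftPow hΓ u a
  simp only [sqError, meanMatrix, Matrix.of_apply]
  fun_prop

theorem lintegral_lintegral_sum_sq_le {α β κ : Type*} [MeasurableSpace α] [MeasurableSpace β]
    [Fintype κ] (P : Measure α) (Q : Measure β) [SFinite P] [SFinite Q] {e : κ → α → β → ℝ}
    (he : ∀ i, Measurable (Function.uncurry (e i))) {C : ℝ} (hC : 0 ≤ C)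
    (h : ∀ i, ∫⁻ a, ∫⁻ b, ENNReal.ofReal (e i a b ^ 2) ∂Q ∂P ≤ ENNReal.ofReal C) :
    ∫⁻ a, ∫⁻ b, ENNReal.ofReal (∑ i, e i a b ^ 2) ∂Q ∂P ≤
      ENNReal.ofReal (Fintype.card κ * C) := by
  have h1 := lintegral_ofReal_const_mul_sum_le (P := P.prod Q) Finset.univ he zero_le_one
    (b := fun _ => C) (fun _ => hC) (fun i _ => by
      rw [lintegral_prod _ (((he i).pow_const 2).ennreal_ofReal).aemeasurable]
      exact h i)
  rw [lintegral_prod _ (Measurable.aemeasurable (by fun_prop))] at h1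
  simpa using h1

theorem IsPoincare.lintegral_sqError_le [IsProbabilityMeasure D]
    [IsProbabilityMeasure (mixture D w μ)] (hD : IsPoincare 1 D) (hw : ∀ i, 0 ≤ w i)
    (hw1 : ∑ i, w i = 1) {c r : ℕ} {Γ : Matrix (Fin c) (Fin r → Fin d) ℝ}
    (hΓ : Γ * Γ.transpose = 1) {m : ℕ} (hm : 0 < m) :
    ∫⁻ z, ∫⁻ x, ENNReal.ofReal (sqError D w μ Γ z x)
        ∂(Measure.pi fun _ : Fin m => Measure.pi fun _ : Fin (4 * (r + 1) - 1) => D)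
        ∂(Measure.pi fun _ : Fin m => mixture D w μ) ≤
      ENNReal.ofReal ((d * c : ℝ) ^ 2 * (secondMomentBound μ (2 * (r + 1)) / m)) := by
  have h := lintegral_lintegral_sum_sq_le (Measure.pi fun _ : Fin m => mixture D w μ)
    (Measure.pi fun _ : Fin m => Measure.pi fun _ : Fin (4 * (r + 1) - 1) => D)
    (e := fun (q : (Fin d × Fin c) × (Fin d × Fin c)) z x =>
      estimateMoment D Γ z x q.1 q.2 - meanMatrix w μ Γ q.1 q.2)
    (fun q => (measurable_estimateMoment_apply (Γ := fun _ => Γ) (fun _ _ => measurable_const)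
      measurable_fst measurable_snd q.1 q.2).sub_const _)
    (div_nonneg (secondMomentBound_nonneg _) (Nat.cast_nonneg m))
    (fun q => hD.lintegral_estimateMoment_sub_sq_le hw hw1 hΓ hm q.1 q.2)
  have hcard : (Fintype.card ((Fin d × Fin c) × (Fin d × Fin c)) : ℝ) = (d * c : ℝ) ^ 2 := by
    simp only [Fintype.card_prod, Fintype.card_fin]; push_cast; ring
  rw [hcard] at h
  refine le_trans (le_of_eq ?_) h
  refine lintegral_congr fun z => lintegral_congr fun x => ?_
  rw [sqError]
  exact congrArg _ (Fintype.sum_prod_type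
    (f := fun q : (Fin d × Fin c) × (Fin d × Fin c) =>
      (estimateMoment D Γ z x q.1 q.2 - meanMatrix w μ Γ q.1 q.2) ^ 2)).symm

/-- The positions of the samples of one batch. -/
def batchIndex (r : Fin t) (i : Fin (n / t)) : Fin n :=
  Fin.castLE (Nat.mul_div_le n t) (finProdFinEquiv (r, i))

theorem batchIndex_eq_iff {r r' : Fin t} {i i' : Fin (n / t)} :
    batchIndex r i = batchIndex r' i' ↔ r = r' ∧ i = i' := by
  unfold batchIndex
  rw [(Fin.castLE_injective _).eq_iff, finProdFinEquiv.injective.eq_iff, Prod.mk.injEq]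

/-- The squared error in step `r + 1` of the run. -/
def runError (D : Measure (Vec d)) (svd : Routine k d) (w : Fin k → ℝ) (μ : Fin k → Vec d)
    (r : Fin t) (ω : Samples d n t) : ℝ :=
  sqError D w μ (runProj D svd ω r) (batch ω.1 r) (ω.2 r)

theorem measurable_runError [IsProbabilityMeasure D] (hsvd : IsSingularRoutine svd) (r : Fin t) :
    Measurable (runError D svd w μ r : Samples d n t → ℝ) :=
  measurable_sqError (measurable_runProj_apply hsvd r) ((measurable_batch _).comp measurable_fst)
    ((measurable_pi_apply _).comp measurable_snd)

/-- Integrate out first the `D`-samples of step `r`, then the mixture samples of its batch. Neither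
affects `runProj` at level `r`, so the inner integral is the error for a fixed `Γ` with orthonormal
rows. -/
theorem IsPoincare.lintegral_runError_le [IsProbabilityMeasure D]
    [IsProbabilityMeasure (mixture D w μ)] (hD : IsPoincare 1 D) (hw : ∀ i, 0 ≤ w i)
    (hw1 : ∑ i, w i = 1) (hsvd : IsSingularRoutine svd) (hm : 0 < n / t) (r : Fin t) :
    ∫⁻ ω, ENNReal.ofReal (runError D svd w μ r ω) ∂(sampleLaw D w μ n t) ≤
      ENNReal.ofReal ((d * rows k d r : ℝ) ^ 2 *
        (secondMomentBound μ (2 * (r + 1)) / (n / t : ℕ))) := by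
  set ν : ∀ r : Fin t, Measure (Fin (n / t) → Fin (4 * ((r : ℕ) + 1) - 1) → Vec d) :=
    fun _ => Measure.pi fun _ => Measure.pi fun _ => D with hν
  have hFm : Measurable fun ω : Samples d n t => ENNReal.ofReal (runError D svd w μ r ω) :=
    (measurable_runError hsvd r).ennreal_ofReal
  set s : Finset (Fin n) := Finset.univ.image (batchIndex (n := n) r) with hs
  set G : (Fin n → Vec d) →
      (∀ r : Fin t, Fin (n / t) → Fin (4 * ((r : ℕ) + 1) - 1) → Vec d) → ℝ≥0∞ := fun Z X =>
    ∫⁻ x, ENNReal.ofReal (sqError D w μ (runProj D svd (Z, X) r) (batch Z r) x) ∂ν r with hG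
  have hGm : Measurable (Function.uncurry G) := by
    have h := measurable_sqError (D := D) (w := w) (μ := μ)
      (Γ := fun q : Samples d n t × (Fin (n / t) → Fin (4 * ((r : ℕ) + 1) - 1) → Vec d) =>
        runProj D svd q.1 r) (z := fun q => batch q.1.1 r) (x := fun q => q.2)
      (fun a η => (measurable_runProj_apply hsvd r a η).comp measurable_fst)
      ((measurable_batch r).comp (measurable_fst.comp measurable_fst)) measurable_snd
    exact (h.ennreal_ofReal).lintegral_prod_right'
  have hXstep : ∀ Z, ∫⁻ X, ENNReal.ofReal (runError D svd w μ r (Z, X)) ∂(Measure.pi ν) =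
      ∫⁻ X, G Z X ∂(Measure.pi ν) := by
    intro Z
    have hm : Measurable fun X => ENNReal.ofReal (runError D svd w μ r (Z, X)) :=
      hFm.comp measurable_prodMk_left
    rw [← lintegral_pi_update ν hm r]
    refine lintegral_congr fun X => lintegral_congr fun x => ?_
    simp only [runError]
    rw [runProj_congr (ω := (Z, Function.update X r x)) (ω' := (Z, X)) r (fun _ _ => rfl) fun r' hr' =>
      Function.update_of_ne (Fin.ne_of_lt hr') _ _, Function.update_self]
  have hZstep : ∀ X, ∫⁻ Z, G Z X ∂(Measure.pi fun _ : Fin n => mixture D w μ) ≤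
      ENNReal.ofReal ((d * rows k d r : ℝ) ^ 2 *
        (secondMomentBound μ (2 * (r + 1)) / (n / t : ℕ))) := by
    intro X
    have hGX : Measurable fun Z => G Z X := hGm.of_uncurry_right
    rw [← lintegral_lmarginal (fun _ : Fin n => mixture D w μ) hGX s]
    have hle : ∀ Z, lmarginal (fun _ : Fin n => mixture D w μ) s
        (fun Z => G Z X) Z ≤ ENNReal.ofReal ((d * rows k d r : ℝ) ^ 2 *
        (secondMomentBound μ (2 * (r + 1)) / (n / t : ℕ))) := by
      intro Z
      set g : (Fin (n / t) → Vec d) → ℝ≥0∞ := fun z =>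
        ∫⁻ x, ENNReal.ofReal (sqError D w μ (runProj D svd (Z, X) r) z x) ∂ν r with hg
      have hgm : Measurable g := by
        have h := measurable_sqError (D := D) (w := w) (μ := μ)
          (Γ := fun _ : (Fin (n / t) → Vec d) ×
            (Fin (n / t) → Fin (4 * ((r : ℕ) + 1) - 1) → Vec d) => runProj D svd (Z, X) r)
          (fun _ _ => measurable_const) measurable_fst measurable_snd
        exact (h.ennreal_ofReal).lintegral_prod_right'
      -- Resampling the coordinates in `s` leaves the earlier batches alone, so the projection stays
      -- the one computed from `Z`.
      have h1 : lmarginal (fun _ : Fin n => mixture D w μ) s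
          (fun Z => G Z X) Z =
          lmarginal (fun _ : Fin n => mixture D w μ) s
            (g ∘ fun Z' i => Z' (batchIndex r i)) Z := by
        refine lintegral_congr fun y => ?_
        simp only [Function.comp_apply, hG, hg]
        rw [runProj_congr (ω := (Function.updateFinset Z s y, X)) (ω' := (Z, X)) r ?_
          fun _ _ => rfl]
        · rfl
        · intro r' hr'
          funext i
          have hni : batchIndex r' i ∉ s := by
            intro h
            obtain ⟨i', _, h⟩ := Finset.mem_image.1 h
            exact (Fin.ne_of_lt hr') (batchIndex_eq_iff.1 h).1.symm
          exact dif_neg hni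
      have hinj : Function.Injective (batchIndex (n := n) r) := fun i i' h =>
        (batchIndex_eq_iff.1 h).2
      have h2 := lmarginal_image (μ := fun _ : Fin n => mixture D w μ) hinj Finset.univ hgm Z
      rw [lmarginal_univ] at h2
      rw [h1]
      refine h2.le.trans ?_
      exact hD.lintegral_sqError_le hw hw1 (runProj_mul_transpose hsvd _ _ r.2.le) hm
    refine (lintegral_mono hle).trans_eq ?_
    rw [lintegral_const, measure_univ, mul_one]
  rw [sampleLaw, lintegral_prod _ hFm.aemeasurable]
  refine (lintegral_congr hXstep).trans_le ?_
  rw [lintegral_lintegral_swap hGm.aemeasurable]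
  refine (lintegral_mono hZstep).trans_eq ?_
  rw [lintegral_const, measure_univ, mul_one]

end Run

/-! ### Accumulated loss, choice of constants and union bound -/

section Conclusion

variable {d k n t : ℕ} {D : Measure (Vec d)} {svd : Routine k d} {w : Fin k → ℝ}
  {μ : Fin k → Vec d}

theorem runProj_one_mulVec_tensorPow (ω : Samples d n t) (u : Vec d) :
    (runProj D svd ω 1).mulVec (tensorPow u 1) ⬝ᵥ (runProj D svd ω 1).mulVec (tensorPow u 1) =
      ‖u‖ ^ 2 := by
  have h0 : (runProj D svd ω 0).mulVec (tensorPow u 0) = fun _ => 1 := by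
    funext a
    simp [runProj, Matrix.mulVec, dotProduct, tensorPow]
  have h1 : (runProj D svd ω 1).mulVec (tensorPow u 1) = fun a : Fin d => u a := by
    have hl : liftPow (runProj D svd ω 0) u = fun b => u b.1 := by
      funext b
      rw [liftPow, h0, mul_one]
    rw [runProj, nestStep_mulVec_tensorPow, hl]
    funext a
    rw [Matrix.mulVec, dotProduct, Fintype.sum_prod_type]
    revert a
    intro (a : Fin d)
    change ∑ b : Fin d, ∑ _ : Fin 1, (if a = b then (1 : ℝ) else 0) * u b = u a
    simp
  rw [h1, EuclideanSpace.real_norm_sq_eq]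
  exact Finset.sum_congr rfl fun a _ => (sq _).symm

/-- Level `s + 1` has suffered only `s` losses, since the first projection is the identity. Passing
to the next level multiplies the squared norm by `‖μ i‖²` and subtracts at most `ε`. -/
theorem le_runProj_mulVec_tensorPow (hsvd : IsSingularRoutine svd) (hw : ∀ i, 0 ≤ w i)
    (ω : Samples d n t) {δ ε : ℝ} (hδ : 0 ≤ δ)
    (h : ∀ r : Fin t, 1 ≤ (r : ℕ) → runError D svd w μ r ω ≤ δ ^ 2) {i : Fin k}
    (hμ : 1 ≤ ‖μ i‖) (hwi : 0 < w i) (hwε : 2 * δ ≤ w i * ε) (s : ℕ) (hs : s + 1 ≤ t) :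
    (1 - s * ε) * (‖μ i‖ ^ 2) ^ (s + 1) ≤
      (runProj D svd ω (s + 1)).mulVec (tensorPow (μ i) (s + 1)) ⬝ᵥ
        (runProj D svd ω (s + 1)).mulVec (tensorPow (μ i) (s + 1)) := by
  have hε : 0 ≤ ε := by
    by_contra hneg
    have := mul_neg_of_pos_of_neg hwi (not_le.1 hneg)
    linarith
  induction s with
  | zero => rw [runProj_one_mulVec_tensorPow]; simp
  | succ s ih =>
    have hst : s + 1 < t := by omega
    have ih' := ih (by omega)
    have herr := h ⟨s + 1, hst⟩ (by simp)
    have hrows : rows k d (s + 2) =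
        min k (Fintype.card (Fin d × Fin (rows k d (s + 1)))) := by
      simp [rows]
    rw [runProj, nestStep_mulVec_tensorPow]
    have hstep : stepMatrix D svd ω (s + 1) (runProj D svd ω (s + 1)) =
        svd (s + 1) (estimateMoment D (runProj D svd ω (s + 1)) (batch ω.1 ⟨s + 1, hst⟩)
          (ω.2 ⟨s + 1, hst⟩)) := by
      rw [stepMatrix, dif_pos hst]
    rw [hstep]
    have hmain := ((hsvd (s + 1)).1 (estimateMoment D (runProj D svd ω (s + 1))
      (batch ω.1 ⟨s + 1, hst⟩) (ω.2 ⟨s + 1, hst⟩))).le_mulVec_dotProduct hrows hw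
      (u := fun i => liftPow (runProj D svd ω (s + 1)) (μ i)) hδ herr i
    rw [liftPow_dotProduct_self] at hmain
    set N := (runProj D svd ω (s + 1)).mulVec (tensorPow (μ i) (s + 1)) ⬝ᵥ
        (runProj D svd ω (s + 1)).mulVec (tensorPow (μ i) (s + 1))
    have h2 := sub_le_comm.1 (le_of_mul_le_mul_left (hmain.trans hwε) hwi)
    refine le_trans ?_ h2
    have hpow : 1 ≤ (‖μ i‖ ^ 2) ^ (s + 2) := one_le_pow₀ (one_le_pow₀ hμ)
    have h4 : ‖μ i‖ ^ 2 * ((1 - s * ε) * (‖μ i‖ ^ 2) ^ (s + 1)) ≤ ‖μ i‖ ^ 2 * N := by gcongr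
    have h5 : ‖μ i‖ ^ 2 * ((1 - s * ε) * (‖μ i‖ ^ 2) ^ (s + 1)) =
        (1 - s * ε) * (‖μ i‖ ^ 2) ^ (s + 2) := by ring
    have h6 : ε ≤ ε * (‖μ i‖ ^ 2) ^ (s + 2) := le_mul_of_one_le_right hε hpow
    push_cast
    rw [h5] at h4
    linarith

theorem le_norm_nestedProj_mulVec (hsvd : IsSingularRoutine svd) (hw : ∀ i, 0 ≤ w i)
    (ω : Samples d n t) {δ ε : ℝ} (hδ : 0 ≤ δ) (hε : 0 ≤ ε)
    (h : ∀ r : Fin t, 1 ≤ (r : ℕ) → runError D svd w μ r ω ≤ δ ^ 2) {i : Fin k}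
    (hμ : 1 ≤ ‖μ i‖) (hwi : 0 < w i) (hwε : 2 * δ ≤ w i * ε) (s : ℕ) (hs1 : 1 ≤ s) (hs : s ≤ t) :
    (1 - s * ε) * ‖μ i‖ ^ s ≤ ‖(WithLp.toLp 2 ((nestedProj (rows k d) (iterProj D svd ω) s).mulVec
      (tensorPow (μ i) s)) : EuclideanSpace ℝ (Fin (rows k d s)))‖ := by
  rw [nestedProj_iterProj]
  obtain ⟨s, rfl⟩ : ∃ s', s = s' + 1 := ⟨s - 1, by omega⟩
  have hle := le_runProj_mulVec_tensorPow hsvd hw ω hδ h hμ hwi hwε s hs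
  rcases lt_or_ge (1 - ((s + 1 : ℕ) : ℝ) * ε) 0 with hneg | hpos
  · exact (mul_nonpos_of_nonpos_of_nonneg hneg.le (by positivity)).trans (norm_nonneg _)
  · refine (pow_le_pow_iff_left₀ (by positivity) (norm_nonneg _) two_ne_zero).1 ?_
    rw [EuclideanSpace.real_norm_sq_eq]
    calc ((1 - ((s + 1 : ℕ) : ℝ) * ε) * ‖μ i‖ ^ (s + 1)) ^ 2
        = (1 - ((s + 1 : ℕ) : ℝ) * ε) ^ 2 * (‖μ i‖ ^ 2) ^ (s + 1) := by ring
      -- Squaring a number in `[0, 1]` does not increase it, so a loss bound for squared norms gives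
      -- one for norms.
      _ ≤ (1 - s * ε) * (‖μ i‖ ^ 2) ^ (s + 1) := by
          gcongr
          push_cast at hpos ⊢
          have : 0 ≤ ((s : ℝ) + 1) * ε := by positivity
          nlinarith
      _ ≤ _ := hle
      _ = _ := by simp [dotProduct, sq]

theorem rows_le_mul (hk : 0 < k) (hd : 0 < d) (r : ℕ) : rows k d r ≤ k * d := by
  match r with
  | 0 => exact Nat.mul_pos hk hd
  | 1 => exact Nat.le_mul_of_pos_left d hk
  | r + 2 => exact (min_le_left _ _).trans (Nat.le_mul_of_pos_right k hd)

theorem secondMomentBound_le (ht : 2 ≤ t) {N : ℕ} (hN1 : 1 ≤ N) (hN : N ≤ 2 * t) :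
    secondMomentBound μ N ≤ 4 * ((t : ℝ) ^ t) ^ 20 * (muMax μ ^ t) ^ 4 := by
  have hM : 1 ≤ muMax μ := one_le_muMax
  have ht2 : (2 : ℝ) ≤ t := by exact_mod_cast ht
  have hN' : (N : ℝ) ≤ 2 * t := by exact_mod_cast hN
  have hNone : (1 : ℝ) ≤ N := by exact_mod_cast hN1
  have hfac : (N.factorial : ℝ) ≤ (N : ℝ) ^ N := by exact_mod_cast Nat.factorial_le_pow N
  -- `2 N ≤ 4 t ≤ t³` since `t ≥ 2`; similarly `N ≤ t²` below. Squaring turns `6 t` and `4 t` into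
  -- the total exponent `20 t`.
  have h1 : (2 * N : ℝ) ^ N ≤ (t : ℝ) ^ (6 * t) := by
    calc (2 * N : ℝ) ^ N ≤ ((t : ℝ) ^ 3) ^ N := by
          gcongr
          have h4 : (4 : ℝ) ≤ t * t := by nlinarith
          nlinarith
      _ ≤ ((t : ℝ) ^ 3) ^ (2 * t) := pow_le_pow_right₀ (one_le_pow₀ (by linarith)) hN
      _ = (t : ℝ) ^ (6 * t) := by rw [← pow_mul]; ring_nf
  have h2 : (N : ℝ) ^ N ≤ (t : ℝ) ^ (4 * t) := by
    calc (N : ℝ) ^ N ≤ ((t : ℝ) ^ 2) ^ N := by gcongr; nlinarith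
      _ ≤ ((t : ℝ) ^ 2) ^ (2 * t) := pow_le_pow_right₀ (one_le_pow₀ (by linarith)) hN
      _ = (t : ℝ) ^ (4 * t) := by rw [← pow_mul]; ring_nf
  have h3 : (muMax μ ^ 2) ^ N ≤ (muMax μ ^ t) ^ 4 := by
    rw [← pow_mul, ← pow_mul]
    exact pow_le_pow_right₀ hM (by omega)
  rw [secondMomentBound, ← mul_pow, mul_comm (N : ℝ) 2]
  calc 4 * (((2 * N : ℝ) ^ N) ^ 2 * ((N.factorial : ℝ) ^ 2 * (muMax μ ^ 2) ^ N))
      ≤ 4 * (((t : ℝ) ^ (6 * t)) ^ 2 * (((t : ℝ) ^ (4 * t)) ^ 2 * (muMax μ ^ t) ^ 4)) := by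
        gcongr
        exact hfac.trans h2
    _ = 4 * ((t : ℝ) ^ t) ^ 20 * (muMax μ ^ t) ^ 4 := by
        ring

/-- The failure probability of a step, summed over the steps, when `n` is large. -/
theorem sum_failure_le (ht : 2 ≤ t) (hk : 0 < k) (hd : 0 < d) {wε : ℝ} (hwε : 0 < wε)
    (hwε1 : wε ≤ 1)
    (hn : ((t : ℝ) ^ t * muMax μ ^ t * k * d / wε) ^ 30 ≤ (n : ℝ)) :
    0 < n / t ∧
    (t : ℝ) * ((d * ((k : ℝ) * d)) ^ 2 * ((4 * ((t : ℝ) ^ t) ^ 20 * (muMax μ ^ t) ^ 4) /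
      (n / t : ℕ)) / (wε / 2) ^ 2) ≤ (n : ℝ) ^ (-0.2 : ℝ) := by
  set X := (t : ℝ) ^ t * muMax μ ^ t * k * d / wε with hX
  have hM : 1 ≤ muMax μ ^ t := one_le_pow₀ one_le_muMax
  have ht2 : (2 : ℝ) ≤ t := by exact_mod_cast ht
  have hk1 : (1 : ℝ) ≤ k := by exact_mod_cast hk
  have hd1 : (1 : ℝ) ≤ d := by exact_mod_cast hd
  have hT : (t : ℝ) ^ 2 ≤ (t : ℝ) ^ t := pow_le_pow_right₀ (by linarith) ht
  have hT4 : 4 ≤ (t : ℝ) ^ t := by nlinarith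
  have hY : 1 ≤ 1 / wε := by rw [le_div_iff₀ hwε]; linarith
  set T := (t : ℝ) ^ t
  set M := muMax μ ^ t
  have hX' : X = T * M * k * d * (1 / wε) := by rw [hX]; ring
  have hXT : T ≤ X := by
    rw [hX', mul_assoc, mul_assoc, mul_assoc]
    exact le_mul_of_one_le_right (by linarith) (one_le_mul_of_one_le_of_one_le hM
      (one_le_mul_of_one_le_of_one_le hk1 (one_le_mul_of_one_le_of_one_le hd1 hY)))
  have hX1 : 1 ≤ X := by linarith
  have hnX : X ≤ n := (le_self_pow₀ hX1 (by norm_num)).trans hn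
  have hn0 : (0 : ℝ) < n := by linarith
  have htn : t ≤ n := by
    have : (t : ℝ) ≤ n := by nlinarith
    exact_mod_cast this
  have hm : 0 < n / t := Nat.div_pos htn (by omega)
  refine ⟨hm, ?_⟩
  have hm1 : (n : ℝ) ≤ 2 * t * (n / t : ℕ) := by
    have h1 : n < t * (n / t) + t := by
      have := Nat.div_add_mod n t
      have := Nat.mod_lt n (by omega : 0 < t)
      omega
    have h2 : t ≤ t * (n / t) := Nat.le_mul_of_pos_right t hm
    have h3 : n ≤ 2 * t * (n / t) := by nlinarith
    exact_mod_cast h3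
  set m : ℝ := ((n / t : ℕ) : ℝ) with hmdef
  have hm0 : 0 < m := by rw [hmdef]; exact_mod_cast hm
  have hinv : 1 / m ≤ 2 * t / n := by
    rw [div_le_div_iff₀ hm0 hn0]; linarith
  calc (t : ℝ) * ((d * ((k : ℝ) * d)) ^ 2 * ((4 * T ^ 20 * M ^ 4) / m) / (wε / 2) ^ 2)
      = 16 * t * (k ^ 2 * d ^ 4 * T ^ 20 * M ^ 4 * (1 / wε) ^ 2) * (1 / m) := by
        field_simp; ring
    _ ≤ 16 * t * (k ^ 2 * d ^ 4 * T ^ 20 * M ^ 4 * (1 / wε) ^ 2) * (2 * t / n) := by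
        gcongr
    _ = 32 * t ^ 2 * (k ^ 2 * d ^ 4 * T ^ 20 * M ^ 4 * (1 / wε) ^ 2) / n := by ring
    -- All factors are at least `1`, so every exponent may be raised to `24` to form a power of `X`;
    -- `T ^ 4` absorbs `32 t ^ 2`.
    _ ≤ T ^ 4 * (k ^ 24 * d ^ 24 * T ^ 20 * M ^ 24 * (1 / wε) ^ 24) / n := by
        have h32 : 32 * (t : ℝ) ^ 2 ≤ T ^ 4 := by
          calc 32 * (t : ℝ) ^ 2 ≤ 4 ^ 3 * T := by nlinarith
            _ ≤ T ^ 3 * T := by gcongr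
            _ = T ^ 4 := by ring
        gcongr <;> first | assumption | norm_num
    _ = X ^ 24 / n := by rw [hX']; ring
    -- The origin of the exponent `30`: `24 / 30 = 0.8`.
    _ ≤ (n : ℝ) ^ (0.8 : ℝ) / n := by
        gcongr
        calc X ^ 24 = (X ^ 30) ^ (0.8 : ℝ) := by
              rw [← Real.rpow_natCast, ← Real.rpow_natCast, ← Real.rpow_mul (by linarith)]
              norm_num
          _ ≤ (n : ℝ) ^ (0.8 : ℝ) := by
              apply Real.rpow_le_rpow (by positivity) hn (by norm_num)
    _ = (n : ℝ) ^ (-0.2 : ℝ) := by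
        rw [show (-0.2 : ℝ) = 0.8 - 1 by norm_num, Real.rpow_sub hn0, Real.rpow_one]

instance isProbabilityMeasure_sampleLaw [IsProbabilityMeasure D]
    [IsProbabilityMeasure (mixture D w μ)] : IsProbabilityMeasure (sampleLaw D w μ n t) := by
  unfold sampleLaw; infer_instance

/-- Markov's inequality and a union bound. Covering the whole space by `G` and the bad events avoids
any measurability requirement on `G`. -/
theorem one_sub_le_measureReal {Ω : Type*} [MeasurableSpace Ω] {P : Measure Ω}
    [IsProbabilityMeasure P] {m : ℕ} {f : Fin m → Ω → ℝ} (hf : ∀ r, Measurable (f r)) {b c : ℝ}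
    (hb : 0 ≤ b) (hc : 0 < c)
    (h : ∀ r, ∫⁻ ω, ENNReal.ofReal (f r ω) ∂P ≤ ENNReal.ofReal b) {G : Set Ω}
    (hG : ∀ ω, (∀ r, f r ω ≤ c) → ω ∈ G) : 1 - m * (b / c) ≤ P.real G := by
  have hbad : ∀ r, P.real {ω | ENNReal.ofReal c ≤ ENNReal.ofReal (f r ω)} ≤ b / c := by
    intro r
    have h1 := meas_ge_le_lintegral_div (μ := P) (hf r).ennreal_ofReal.aemeasurable
      (ε := ENNReal.ofReal c) (by simpa using hc) ENNReal.ofReal_ne_top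
    have h2 := h1.trans (ENNReal.div_le_div_right (h r) _)
    rw [← ENNReal.ofReal_div_of_pos hc] at h2
    exact ENNReal.toReal_le_of_le_ofReal (by positivity) h2
  have hcover : (Set.univ : Set Ω) ⊆
      G ∪ ⋃ r, {ω | ENNReal.ofReal c ≤ ENNReal.ofReal (f r ω)} := by
    intro ω _
    by_cases hω : ∀ r, f r ω ≤ c
    · exact Or.inl (hG ω hω)
    · push Not at hω
      obtain ⟨r, hr⟩ := hω
      exact Or.inr (Set.mem_iUnion.2 ⟨r, ENNReal.ofReal_le_ofReal hr.le⟩)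
  have h1 : (1 : ℝ) ≤ P.real G + ∑ r, P.real {ω | ENNReal.ofReal c ≤ ENNReal.ofReal (f r ω)} := by
    calc (1 : ℝ) = P.real Set.univ := by simp
      _ ≤ _ := measureReal_mono hcover
      _ ≤ _ := measureReal_union_le _ _
      _ ≤ _ := by gcongr; exact measureReal_iUnion_fintype_le _
  have h2 : ∑ r, P.real {ω | ENNReal.ofReal c ≤ ENNReal.ofReal (f r ω)} ≤ m * (b / c) := by
    refine (Finset.sum_le_sum fun r _ => hbad r).trans_eq ?_
    simp
  linarith

end Conclusion

end ImplicitMoments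

end

theorem lemma6p2 :
    ∃ C : ℕ, ∀ (d k n t : ℕ) (D : MeasureTheory.Measure (ImplicitMoments.Vec d))
      (w : Fin k → ℝ) (μ : Fin k → ImplicitMoments.Vec d) (wstar ε : ℝ)
      (svd : ImplicitMoments.Routine k d),
      MeasureTheory.IsProbabilityMeasure D → ImplicitMoments.IsPoincare 1 D →
      (∀ i, 0 ≤ w i) → ∑ i, w i = 1 →
      0 < t → 0 < wstar → 0 < ε →
      ImplicitMoments.IsSingularRoutine svd →
      ((t : ℝ) ^ t * ImplicitMoments.muMax μ ^ t * k * d / (wstar * ε)) ^ C ≤ (n : ℝ) →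
      1 - (n : ℝ) ^ (-0.2 : ℝ) ≤
        (ImplicitMoments.sampleLaw D w μ n t).real
          {ω | ∀ i, 1 ≤ ‖μ i‖ → wstar ≤ w i → ∀ s : ℕ, 1 ≤ s → s ≤ t →
            (1 - s * ε) * ‖μ i‖ ^ s ≤
              ‖(WithLp.toLp 2
                ((ImplicitMoments.nestedProj (ImplicitMoments.rows k d)
                    (ImplicitMoments.iterProj D svd ω) s).mulVec
                  (ImplicitMoments.tensorPow (μ i) s)) :
                EuclideanSpace ℝ (Fin (ImplicitMoments.rows k d s)))‖} := by
  refine ⟨30, ?_⟩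
  intro d k n t D w μ wstar ε svd hprob hD hw hw1 ht hwstar hε hsvd hn
  have : IsProbabilityMeasure (ImplicitMoments.mixture D w μ) :=
    ImplicitMoments.isProbabilityMeasure_mixture hw hw1
  -- The numerical estimates need these bounds. Outside them the conclusion holds for every outcome.
  by_cases hreg : 2 ≤ t ∧ wstar ≤ 1 ∧ ε ≤ 1 ∧ 0 < d
  · obtain ⟨ht2, hws1, hε1, hd⟩ := hreg
    have hk : 0 < k := by
      rcases Nat.eq_zero_or_pos k with rfl | hk
      · simp at hw1
      · exact hk
    -- With this tolerance `δ`, `2 δ = wstar * ε ≤ w i * ε`.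
    have hδ : 0 < wstar * ε / 2 := by positivity
    obtain ⟨hm, hfail⟩ := ImplicitMoments.sum_failure_le ht2 hk hd (mul_pos hwstar hε)
      (mul_le_one₀ hws1 hε.le hε1) hn
    refine le_trans ?_ (ImplicitMoments.one_sub_le_measureReal
      (f := fun r => ImplicitMoments.runError D svd w μ r)
      (fun r => ImplicitMoments.measurable_runError hsvd r)
      (b := (d * ((k : ℝ) * d)) ^ 2 * ((4 * ((t : ℝ) ^ t) ^ 20 *
        (ImplicitMoments.muMax μ ^ t) ^ 4) / (n / t : ℕ)))
      (c := (wstar * ε / 2) ^ 2) ?_ (by positivity) (fun r => ?_) (fun ω hω => ?_))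
    · linarith
    · have := ImplicitMoments.one_le_muMax (μ := μ)
      positivity
    · refine (hD.lintegral_runError_le hw hw1 hsvd hm r).trans (ENNReal.ofReal_le_ofReal ?_)
      have hrows : (ImplicitMoments.rows k d r : ℝ) ≤ k * d := by
        exact_mod_cast ImplicitMoments.rows_le_mul hk hd r
      have hB := ImplicitMoments.secondMomentBound_le (μ := μ) ht2
        (N := 2 * ((r : ℕ) + 1)) (by omega) (by have := r.2; omega)
      have hB0 := ImplicitMoments.secondMomentBound_nonneg (μ := μ) (2 * ((r : ℕ) + 1))
      gcongr
    · intro i hμi hwi s hs1 hs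
      refine ImplicitMoments.le_norm_nestedProj_mulVec hsvd hw ω hδ.le hε.le (fun r _ => hω r) hμi
        (hwstar.trans_le hwi) ?_ s hs1 hs
      have := mul_le_mul_of_nonneg_right hwi hε.le
      linarith
  · have hall : ∀ ω : ImplicitMoments.Samples d n t, ∀ i, 1 ≤ ‖μ i‖ → wstar ≤ w i →
        ∀ s : ℕ, 1 ≤ s → s ≤ t → (1 - s * ε) * ‖μ i‖ ^ s ≤
          ‖(WithLp.toLp 2 ((ImplicitMoments.nestedProj (ImplicitMoments.rows k d)
            (ImplicitMoments.iterProj D svd ω) s).mulVec (ImplicitMoments.tensorPow (μ i) s)) :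
            EuclideanSpace ℝ (Fin (ImplicitMoments.rows k d s)))‖ := by
      intro ω i hμi hwi s hs1 hs
      by_cases hε1 : ε ≤ 1
      · have hws1 : wstar ≤ 1 := hwi.trans
          (hw1 ▸ Finset.single_le_sum (fun j _ => hw j) (Finset.mem_univ i))
        have hd : 0 < d := by
          rcases Nat.eq_zero_or_pos d with rfl | hd
          · have h0 : μ i = 0 := Subsingleton.elim _ _
            rw [h0, norm_zero] at hμi
            linarith
          · exact hd
        have ht1 : t < 2 := by
          by_contra h
          exact hreg ⟨by omega, hws1, hε1, hd⟩
        -- For `t = 1` nothing is estimated, so the tolerance can be taken to be `0`.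
        refine ImplicitMoments.le_norm_nestedProj_mulVec hsvd hw ω le_rfl hε.le
          (fun r hr => ?_) hμi (hwstar.trans_le hwi) ?_ s hs1 hs
        · have := r.2
          omega
        · have := mul_nonneg (hw i) hε.le
          linarith
      · refine le_trans (mul_nonpos_of_nonpos_of_nonneg ?_ (by positivity)) (norm_nonneg _)
        have hs' : (1 : ℝ) ≤ s := by exact_mod_cast hs1
        nlinarith
    refine le_trans ?_ (measureReal_mono (s₁ := Set.univ) fun ω _ => hall ω)
    rw [probReal_univ]
    have : 0 ≤ (n : ℝ) ^ (-0.2 : ℝ) := Real.rpow_nonneg (Nat.cast_nonneg n) _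
    linarith
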